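/- **Setting.** A surface is a compact Hausdorff space $\Sigma$ that is locally homeomorphic to open subsets of the closed half-plane; $\partial\Sigma$ denotes its boundary. (Connectedness and orientability are not needed.) Let $\mathcal P$ be a finite set of points of $\Sigma$ (the punctures), and for each $P\in\mathcal P$ let $i_P:[0,1]\to\Sigma$ be a simple arc with $i_P(0)\in\partial\Sigma$, $i_P(1)=P$ and $i_P((0,1])\subset\Sigma\setminus\partial\Sigma$, such that $i_P$ and $i_Q$ meet at most in their starting points if $P\ne Q$. (For instance, $i_P$ may be the folded side of the self-folded triangle around $P$ in an ideal triangulation of a marked surface $(\Sigma,\mathcal M,\mathcal P)$ in which every puncture lies inside a self-folded triangle and no triangle shares a side with two self-folded triangles.) Let $\Sigma^+$ be a surface obtained by cutting $\Sigma$ along the arcs $i_P$. That is, $\Sigma^+$ is a surface with a continuous surjection $q:\Sigma^+\to\Sigma$ and injective continuous maps $\psi_P:[0,1]\to\partial\Sigma^+$, $P\in\mathcal P$, such that $q(\psi_P(t))=i_P(1-|1-2t|)$ for all $P$ and $t$, and $q(x)=q(y)$ if and only if $x$ and $y$ are equivalent under the equivalence relation generated by $\psi_P(t)\sim\psi_P(1-t)$.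 Let $\Sigma^-$ be a second copy of $\Sigma^+$, and let $\widetilde\Sigma$ be the quotient of $\Sigma^+\sqcup\Sigma^-$ by the equivalence relation generated by $\psi_P(t)^+\sim\psi_P(1-t)^-$ ($P\in\mathcal P$, $t\in[0,1]$). Let $p:\widetilde\Sigma\to\Sigma$ be the map given by $q$ on each of the two copies. For a space $X$ and $E\subset X$, let $\pi_1(X,E)$ be the groupoid whose objects are the points of $E$ and whose morphisms are the homotopy classes (relative to endpoints) of paths in $X$ between points of $E$. Let $\pi_1^{\rm orb}(\Sigma,\Sigma\setminus\mathcal P)$ be the quotient of $\pi_1(\Sigma\setminus\mathcal P,\Sigma\setminus\mathcal P)$ by the congruence generated by $e=e^{-1}$ for every loop $e$ that runs once along the boundary circle of a closed disc around a puncture $P$ (embedded in $\Sigma$ as part of a larger open disc) that contains no other puncture; it has the same objects. **Proposition.** The map $p$ induces a functor of groupoids $$\Phi:\pi_1(\widetilde\Sigma,\widetilde\Sigma\setminus p^{-1}(\mathcal P))\longrightarrow\pi_1^{\rm orb}(\Sigma,\Sigma\setminus\mathcal P).$$ That is, there is a unique functor $\Phi$ such that $\Phi\circ S=U\circ T$,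 where $S:\pi_1(\widetilde\Sigma\setminus p^{-1}(\mathcal P),\widetilde\Sigma\setminus p^{-1}(\mathcal P))\to\pi_1(\widetilde\Sigma,\widetilde\Sigma\setminus p^{-1}(\mathcal P))$ is induced by the inclusion, $T:\pi_1(\widetilde\Sigma\setminus p^{-1}(\mathcal P),\widetilde\Sigma\setminus p^{-1}(\mathcal P))\to\pi_1(\Sigma\setminus\mathcal P,\Sigma\setminus\mathcal P)$ is induced by the restriction of $p$, and $U$ is the quotient functor. Moreover, 1. $\Phi$ is faithful; 2. $\Phi$ is surjective on objects, and each object of $\pi_1^{\rm orb}(\Sigma,\Sigma\setminus\mathcal P)$ has exactly two preimages. -/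

import Mathlib

open CategoryTheory Topology Manifold unitInterval

noncomputable section

namespace PuncturedSurface

/-! ### Surfaces, punctures, and cutting along arcs

A surface (with boundary) is a compact Hausdorff space with charts in the closed half-plane.
Its boundary and interior are those of Mathlib's `ModelWithCorners` for the model `𝓡∂ 2`. -/

section Cutting

variable {X : Type*} [TopologicalSpace X] [ChartedSpace (EuclideanHalfSpace 2) X]

/-- A system of arcs joining the punctures to the boundary: every puncture `P` is the end of a
simple arc that starts on the boundary of the surface and otherwise runs in its interior; arcs
of different punctures have at most their starting points in common. In particular all
punctures lie in the interior. -/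
structure ArcSystem (Pu : Set X) where
  arc : Pu → C(I, X)
  arc_injective : ∀ P, Function.Injective (arc P)
  arc_zero : ∀ P, arc P 0 ∈ (𝓡∂ 2).boundary X
  arc_interior : ∀ P t, t ≠ 0 → arc P t ∈ (𝓡∂ 2).interior X
  arc_one : ∀ P, arc P 1 = P
  arc_disjoint : ∀ P Q s t, P ≠ Q → arc P s = arc Q t → s = 0 ∧ t = 0

/-- Folding: with `side P` a parametrization of the segment `[P₁, P₂]`, each of its points
`side P t` is related to its mirror image `side P (1 - t)`. -/
inductive Fold {ι Y : Type*} [TopologicalSpace Y] (side : ι → C(I, Y)) : Y → Y → Prop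
  | mk (P : ι) (t : I) : Fold side (side P t) (side P (σ t))

/-- `Y` (the surface `Σ⁺`) is a surface obtained by cutting the surface `X` along the arcs:
each arc opens up into a boundary segment `side P : [0,1] → ∂Y` (with midpoint over the puncture),
and `regluing : Y → X` glues the two halves of each segment together again and identifies no
other points. The `t`-th point of the segment lies over the point `1 - |1 - 2t|` of the arc. -/
structure Cut {Pu : Set X} (A : ArcSystem Pu) (Y : Type*) [TopologicalSpace Y]
    [ChartedSpace (EuclideanHalfSpace 2) Y] where
  regluing : C(Y, X)
  surjective : Function.Surjective regluing
  side : Pu → C(I, Y)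
  side_injective : ∀ P, Function.Injective (side P)
  side_boundary : ∀ P t, side P t ∈ (𝓡∂ 2).boundary Y
  regluing_side : ∀ (P : Pu) (s t : I), (s : ℝ) = 1 - |1 - 2 * (t : ℝ)| →
    regluing (side P t) = A.arc P s
  regluing_eq_iff : ∀ y y', regluing y = regluing y' ↔ Relation.EqvGen (Fold side) y y'

variable {Pu : Set X} {A : ArcSystem Pu} {Y : Type*} [TopologicalSpace Y]
  [ChartedSpace (EuclideanHalfSpace 2) Y]

/-- The gluing of the two copies `Σ⁺` (`Sum.inl`) and `Σ⁻` (`Sum.inr`): the point `t` of the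
segment of `P` in `Σ⁺` is glued to the point `1 - t` of the segment of `P` in `Σ⁻`. -/
inductive Cut.Glue (c : Cut A Y) : Y ⊕ Y → Y ⊕ Y → Prop
  | mk (P : Pu) (t : I) : Cut.Glue c (Sum.inl (c.side P t)) (Sum.inr (c.side P (σ t)))

/-- The surface `Σ̃`: two copies of the cut surface glued along the segments. -/
def Cut.Cover (c : Cut A Y) : Type _ := Quot c.Glue

instance (c : Cut A Y) : TopologicalSpace c.Cover :=
  inferInstanceAs (TopologicalSpace (Quot c.Glue))

/-- The projection `p : Σ̃ → Σ`, given on each of the two copies by the regluing map. -/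
def Cut.proj (c : Cut A Y) : C(c.Cover, X) where
  toFun := Quot.lift (Sum.elim c.regluing c.regluing) (by
    rintro _ _ ⟨P, t⟩
    exact (c.regluing_eq_iff _ _).2 (.rel _ _ ⟨P, t⟩))
  continuous_toFun :=
    continuous_quot_lift _ (c.regluing.continuous.sumElim c.regluing.continuous)

/-- The complement of `p⁻¹(Pu)` in `Σ̃`. -/
def Cut.regular (c : Cut A Y) : Set c.Cover := (c.proj ⁻¹' Pu)ᶜ

/-- The restriction `Σ̃ ∖ p⁻¹(Pu) → Σ ∖ Pu` of `p`. -/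
def Cut.projRegular (c : Cut A Y) : C(c.regular, (Puᶜ : Set X)) where
  toFun x := ⟨c.proj x.1, x.2⟩
  continuous_toFun := by fun_prop

end Cutting

/-! ### Fundamental groupoids -/

section Groupoids

variable {X : Type*} [TopologicalSpace X]

/-- `π₁(X, E)`: the objects are the points of `E`, the morphisms are all homotopy classes
(relative to the endpoints) of paths in `X` between them. -/
abbrev FundamentalGroupoidOn (X : Type*) [TopologicalSpace X] (E : Set X) : Type _ :=
  InducedCategory (FundamentalGroupoid X) (fun x : E => FundamentalGroupoid.mk x.1)

/-- The functor `π₁(E, E) → π₁(X, E)` induced by the inclusion: the identity on points, and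
on morphisms a path in `E` is regarded as a path in `X`. -/
def inclusionFunctor (E : Set X) : FundamentalGroupoid E ⥤ FundamentalGroupoidOn X E where
  obj x := x.as
  map f := InducedCategory.homMk
    ((FundamentalGroupoid.map (⟨Subtype.val, continuous_subtype_val⟩ : C(E, X))).map f)
  map_id x := by
    ext1
    exact (FundamentalGroupoid.map (⟨Subtype.val, continuous_subtype_val⟩ : C(E, X))).map_id x
  map_comp f g := by
    ext1
    exact (FundamentalGroupoid.map (⟨Subtype.val, continuous_subtype_val⟩ : C(E, X))).map_comp f g

/-- A closed disc around a puncture, embedded in the surface (as part of a larger open disc),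
that contains no other puncture. -/
structure PunctureDisc (Pu : Set X) where
  chart : OpenPartialHomeomorph ℂ X
  closedBall_subset : Metric.closedBall 0 1 ⊆ chart.source
  center_mem : chart 0 ∈ Pu
  eq_center : ∀ z ∈ Metric.closedBall (0 : ℂ) 1, chart z ∈ Pu → z = 0

theorem PunctureDisc.chart_circle_mem {Pu : Set X} (D : PunctureDisc Pu) (θ : ℝ) :
    D.chart (Complex.exp (θ * Complex.I)) ∈ Puᶜ := fun h =>
  Complex.exp_ne_zero _ (D.eq_center _ (by simp [Complex.norm_exp]) h)

/-- The loop in `X ∖ Pu` that runs once along the boundary circle of the disc. -/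
def PunctureDisc.loop {Pu : Set X} (D : PunctureDisc Pu) :
    Path (X := (Puᶜ : Set X)) ⟨_, D.chart_circle_mem 0⟩ ⟨_, D.chart_circle_mem 0⟩ where
  toFun t := ⟨_, D.chart_circle_mem (2 * Real.pi * t)⟩
  continuous_toFun := by
    refine Continuous.subtype_mk ?_ _
    refine D.chart.continuousOn.comp_continuous (by fun_prop) fun t => ?_
    exact D.closedBall_subset (by simp [Complex.norm_exp])
  source' := by simp
  target' := by
    have h : Complex.exp (2 * (Real.pi : ℂ) * Complex.I) = 1 := Complex.exp_two_pi_mul_I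
    simp [h]

/-- The local relation at the punctures: running around a puncture in one direction is the same as
running around it in the other direction. -/
inductive PunctureRel (Pu : Set X) : HomRel (FundamentalGroupoid (Puᶜ : Set X))
  | turn (D : PunctureDisc Pu) : PunctureRel Pu
      (FundamentalGroupoid.fromPath (Path.Homotopic.Quotient.mk D.loop))
      (FundamentalGroupoid.fromPath (Path.Homotopic.Quotient.mk D.loop.symm))

/-- The orbifold fundamental groupoid `π₁ᵒʳᵇ(X, X ∖ Pu)`: the quotient of `π₁(X ∖ Pu)` by the
congruence generated by the local relations at the punctures. It is a groupoid by
`CategoryTheory.Quotient.groupoid`. -/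
abbrev OrbifoldGroupoid (Pu : Set X) : Type _ := CategoryTheory.Quotient (PunctureRel Pu)

/-- The quotient functor `π₁(X ∖ Pu) → π₁ᵒʳᵇ(X, X ∖ Pu)`. -/
abbrev OrbifoldGroupoid.quotientFunctor (Pu : Set X) :
    FundamentalGroupoid (Puᶜ : Set X) ⥤ OrbifoldGroupoid Pu :=
  CategoryTheory.Quotient.functor (PunctureRel Pu)

end Groupoids

end PuncturedSurface

end

namespace PuncturedSurface

/-! ### Local structure of surfaces -/

section LocalStructure

variable {M : Type*} [TopologicalSpace M] [ChartedSpace (EuclideanHalfSpace 2) M]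

/-! Away from the punctures, `p` is a two-sheeted covering whose deck involution exchanges the
copies of `Σ⁺`; around a puncture it looks like `w ↦ w²`. A loop `e` once around a puncture
therefore lifts to an open path, while `e²` lifts to a loop that bounds a disc in `Σ̃`. Imposing `e
= e⁻¹` downstairs thus amounts to filling in the points over the punctures upstairs.

This is made precise by two facts. Every homotopy class in `Σ̃` between regular points contains a
regular path (`Cut.exists_map_regularIncl_eq`). Two classes of regular paths with the same ends
agree in `Σ̃` if and only if their projections agree in the orbifold groupoid
(`Cut.projOrb_eq_iff`). One direction of the equivalence makes the functor well defined, the other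
makes it faithful; the fibres on objects are the orbits of the free involution.

The covering property is checked with two-valued colourings of `Σ⁺` that differ at glued points.
They exist locally off the punctures (`isLocallyColoured_compl`), but not on a punctured
neighbourhood of a puncture, because folding a segment fixes its midpoint. Hence one turn around a
puncture exchanges the sheets (`lift_add_two_pi`), and the cover over a disc is a disc
(`exists_branched_disc`).

From orbifold equality to homotopy: relations are lifted. The lifts of `e` and `e⁻¹` from a common
point are two semicircles in the branched disc, hence homotopic in `Σ̃` (`exists_lifts_loop`), and
path lifting carries this through composition and the generated equivalence (`LiftRel`).

From homotopy to orbifold equality: a van Kampen argument. The orbifold class extends to paths that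
lie in the regular part or over one disc, and a grid subdivision of a homotopy then shows that it is
invariant (`LocalFunctor.map_eq_of_homotopic`). -/

theorem chartAt_apply_zero_of_mem_boundary {v : M} (hv : v ∈ (𝓡∂ 2).boundary M) :
    (chartAt (EuclideanHalfSpace 2) v v).1 0 = 0 := by
  have h : extChartAt (𝓡∂ 2) v v ∈ frontier (Set.range (𝓡∂ 2)) := hv
  have hr : Set.range (𝓡∂ 2) = {y | (0 : ℝ) ≤ y 0} := range_euclideanHalfSpace 2
  rw [hr, frontier_halfSpace] at h
  exact h.symm

theorem chartAt_apply_zero_of_mem_interior {v : M} (hv : v ∈ (𝓡∂ 2).interior M) :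
    0 < (chartAt (EuclideanHalfSpace 2) v v).1 0 := by
  have h : extChartAt (𝓡∂ 2) v v ∈ interior (Set.range (𝓡∂ 2)) := hv
  have hr : Set.range (𝓡∂ 2) = {y | (0 : ℝ) ≤ y 0} := range_euclideanHalfSpace 2
  rw [hr, interior_halfSpace] at h
  exact h

/-- A half-disc without its centre is star-shaped. -/
theorem starConvex_puncturedHalfDisc {c : EuclideanSpace ℝ (Fin 2)} (hc : c 0 = 0) {r : ℝ}
    (hr : 0 < r) :
    StarConvex ℝ (c + EuclideanSpace.single 0 (r / 2))
      {z : EuclideanSpace ℝ (Fin 2) | 0 ≤ z 0 ∧ dist z c < r ∧ z ≠ c} := by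
  intro y ⟨hy0, hyr, hyc⟩ a b ha hb hab
  have hcoord : (a • (c + EuclideanSpace.single (0 : Fin 2) (r / 2)) + b • y) 0
      = a * (r / 2) + b * y 0 := by simp [hc]
  refine ⟨by rw [hcoord]; positivity, ?_, ?_⟩
  · refine convex_ball c r ?_ hyr ha hb hab
    simp [abs_of_pos hr]; linarith
  -- At the centre `c` the coordinate `a * (r / 2) + b * y 0` vanishes; both summands are
  -- nonnegative, so `a = 0` and then `y = c`.
  · intro h
    have h0 := hcoord
    rw [h, hc] at h0
    have ha0 : a = 0 := by
      have : 0 ≤ b * y 0 := by positivity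
      nlinarith
    subst ha0
    obtain rfl : b = 1 := by linarith
    simp at h
    exact hyc h

/-- Boundary points have arbitrarily small open neighbourhoods that become contractible when the
point is removed. -/
theorem exists_contractible_punctured_nhd {v : M} (hv : v ∈ (𝓡∂ 2).boundary M) {N : Set M}
    (hN : N ∈ 𝓝 v) :
    ∃ W : Set M, IsOpen W ∧ v ∈ W ∧ W ⊆ N ∧ ContractibleSpace ↥(W \ {v}) := by
  set φ := chartAt (EuclideanHalfSpace 2) v with hφ
  have hvs : v ∈ φ.source := mem_chart_source _ v
  have hc : (φ v).1 0 = 0 := chartAt_apply_zero_of_mem_boundary hv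
  have hmem : φ.target ∩ φ.symm ⁻¹' N ∈ 𝓝 (φ v) := by
    refine Filter.inter_mem (φ.open_target.mem_nhds (φ.map_source hvs)) ?_
    refine (φ.continuousAt_symm (φ.map_source hvs)).preimage_mem_nhds ?_
    rwa [φ.left_inv hvs]
  obtain ⟨V, hV, hVsub⟩ := mem_nhds_induced Subtype.val _ _ |>.1 hmem
  obtain ⟨r, hr, hrV⟩ := Metric.mem_nhds_iff.1 hV
  have hB : {z : EuclideanHalfSpace 2 | dist z.1 (φ v).1 < r} ⊆ φ.target ∩ φ.symm ⁻¹' N :=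
    fun z hz => hVsub (hrV hz)
  have hBo : IsOpen {z : EuclideanHalfSpace 2 | dist z.1 (φ v).1 < r} :=
    Metric.isOpen_ball.preimage continuous_subtype_val
  refine ⟨φ.symm '' {z | dist z.1 (φ v).1 < r},
    φ.isOpen_image_symm_of_subset_target hBo fun z hz => (hB hz).1,
    ⟨φ v, by simpa using hr, φ.left_inv hvs⟩, ?_, ?_⟩
  · rintro _ ⟨z, hz, rfl⟩
    exact (hB hz).2
  · have himg : φ.symm '' {z | dist z.1 (φ v).1 < r ∧ z.1 ≠ (φ v).1} =
        φ.symm '' {z | dist z.1 (φ v).1 < r} \ {v} := by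
      ext m
      constructor
      · rintro ⟨z, ⟨hz, hne⟩, rfl⟩
        refine ⟨⟨z, hz, rfl⟩, fun h => hne ?_⟩
        rw [← φ.right_inv (hB hz).1, Set.mem_singleton_iff.1 h]
      · rintro ⟨⟨z, hz, rfl⟩, hne⟩
        refine ⟨z, ⟨hz, fun h => hne ?_⟩, rfl⟩
        rw [Set.mem_singleton_iff, Subtype.ext h, φ.left_inv hvs]
    have e1 := φ.symm.homeomorphOfImageSubsetSource (s := {z | dist z.1 (φ v).1 < r ∧
      z.1 ≠ (φ v).1}) (fun z hz => (hB hz.1).1) himg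
    have e2 : {z : EuclideanHalfSpace 2 | dist z.1 (φ v).1 < r ∧ z.1 ≠ (φ v).1} ≃ₜ
        {z : EuclideanSpace ℝ (Fin 2) | 0 ≤ z 0 ∧ dist z (φ v).1 < r ∧ z ≠ (φ v).1} :=
      { toFun z := ⟨z.1.1, z.1.2, z.2⟩
        invFun z := ⟨⟨z.1, z.2.1⟩, z.2.2⟩
        left_inv _ := rfl
        right_inv _ := rfl
        continuous_toFun := by fun_prop
        continuous_invFun := by fun_prop }
    have : ContractibleSpace {z : EuclideanSpace ℝ (Fin 2) |
        0 ≤ z 0 ∧ dist z (φ v).1 < r ∧ z ≠ (φ v).1} := by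
      refine (starConvex_puncturedHalfDisc hc hr).contractibleSpace
        ⟨(φ v).1 + EuclideanSpace.single 0 (r / 2), ?_, ?_, ?_⟩
      · simp [hc]; positivity
      · simp [abs_of_pos hr]; linarith
      · simp [hr.ne']
    exact (e1.symm.trans e2).contractibleSpace

/-- Interior points have arbitrarily small disc charts. -/
theorem exists_disc_chart {v : M} (hv : v ∈ (𝓡∂ 2).interior M) {N : Set M} (hN : N ∈ 𝓝 v) :
    ∃ e : OpenPartialHomeomorph ℂ M, Metric.closedBall 0 1 ⊆ e.source ∧ e 0 = v ∧
      e '' Metric.closedBall 0 1 ⊆ N := by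
  set φ := chartAt (EuclideanHalfSpace 2) v with hφ
  have hvs : v ∈ φ.source := mem_chart_source _ v
  have hc : 0 < (φ v).1 0 := chartAt_apply_zero_of_mem_interior hv
  have hmem : φ.target ∩ φ.symm ⁻¹' N ∈ 𝓝 (φ v) := by
    refine Filter.inter_mem (φ.open_target.mem_nhds (φ.map_source hvs)) ?_
    refine (φ.continuousAt_symm (φ.map_source hvs)).preimage_mem_nhds ?_
    rwa [φ.left_inv hvs]
  obtain ⟨V, hV, hVsub⟩ := mem_nhds_induced Subtype.val _ _ |>.1 hmem
  obtain ⟨r, hr, hrV⟩ := Metric.mem_nhds_iff.1 (Filter.inter_mem hV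
    (show {z : EuclideanSpace ℝ (Fin 2) | 0 < z 0} ∈ 𝓝 (φ v).1 from
      (isOpen_lt continuous_const (by fun_prop)).mem_nhds hc))
  -- The factor `r / 2` puts the closed unit disc inside the open ball of radius `r`.
  let ι : ℂ ≃ₜ EuclideanSpace ℝ (Fin 2) :=
    Complex.orthonormalBasisOneI.repr.toHomeomorph.trans
      ((Homeomorph.smulOfNeZero (r / 2) (by positivity)).trans (Homeomorph.addLeft (φ v).1))
  have hι : ∀ w, ι w = (φ v).1 + (r / 2) • Complex.orthonormalBasisOneI.repr w := fun _ => rfl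
  let j : OpenPartialHomeomorph (EuclideanSpace ℝ (Fin 2)) (EuclideanHalfSpace 2) :=
    { toFun := (𝓡∂ 2).symm
      invFun := Subtype.val
      source := {z | 0 < z 0}
      target := {z | 0 < z.1 0}
      map_source' z hz := by
        have := (𝓡∂ 2).right_inv (x := z) (by
          rw [show Set.range (𝓡∂ 2) = {y | (0 : ℝ) ≤ y 0} from range_euclideanHalfSpace 2]
          exact le_of_lt (show 0 < z 0 from hz))
        change 0 < ((𝓡∂ 2) ((𝓡∂ 2).symm z)) 0
        rw [this]; exact hz
      map_target' z hz := hz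
      left_inv' z hz := (𝓡∂ 2).right_inv (x := z) (by
          rw [show Set.range (𝓡∂ 2) = {y | (0 : ℝ) ≤ y 0} from range_euclideanHalfSpace 2]
          exact le_of_lt (show 0 < z 0 from hz))
      right_inv' z hz := (𝓡∂ 2).left_inv z
      continuousOn_toFun := (𝓡∂ 2).continuous_symm.continuousOn
      continuousOn_invFun := continuous_subtype_val.continuousOn
      open_source := isOpen_lt continuous_const (by fun_prop)
      open_target := isOpen_lt continuous_const (by fun_prop) }
  have hj : ∀ z : EuclideanSpace ℝ (Fin 2), 0 < z 0 → (j z).1 = z := fun z hz => j.left_inv hz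
  have hball : ∀ w ∈ Metric.closedBall (0 : ℂ) 1, ι w ∈ V ∩ {z | 0 < z 0} := by
    intro w hw
    refine hrV ?_
    rw [hι, Metric.mem_ball, dist_eq_norm, add_sub_cancel_left, norm_smul,
      LinearIsometryEquiv.norm_map, Real.norm_of_nonneg (by positivity)]
    have : ‖w‖ ≤ 1 := by simpa using hw
    nlinarith
  have hball' : ∀ w ∈ Metric.closedBall (0 : ℂ) 1, j (ι w) ∈ φ.target ∩ φ.symm ⁻¹' N := by
    intro w hw
    refine hVsub ?_
    rw [Set.mem_preimage, hj _ (hball w hw).2]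
    exact (hball w hw).1
  refine ⟨(ι.toOpenPartialHomeomorph.trans j).trans φ.symm, ?_, ?_, ?_⟩
  · intro w hw
    simp only [OpenPartialHomeomorph.trans_source, Set.mem_inter_iff, Set.mem_preimage]
    exact ⟨⟨Set.mem_univ _, (hball w hw).2⟩, (hball' w hw).1⟩
  · change φ.symm (j (ι 0)) = v
    have : j (ι 0) = φ v := Subtype.ext (by rw [hj _ (hball 0 (by simp)).2, hι]; simp)
    rw [this, φ.left_inv hvs]
  · rintro _ ⟨w, hw, rfl⟩
    exact (hball' w hw).2

end LocalStructure

end PuncturedSurface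

namespace PuncturedSurface

/-! ### The two sheets of the cover -/

section Sheets

variable {X : Type*} [TopologicalSpace X] [ChartedSpace (EuclideanHalfSpace 2) X]
  {Pu : Set X} {A : ArcSystem Pu} {Y : Type*} [TopologicalSpace Y]
  [ChartedSpace (EuclideanHalfSpace 2) Y]

/-- The midpoint of the unit interval. -/
noncomputable def half : I := ⟨1 / 2, by norm_num, by norm_num⟩

theorem symm_half : σ half = half := Subtype.ext (by simp [half]; norm_num)

theorem eq_half_of_symm_eq {t : I} (h : σ t = t) : t = half := by
  have := congrArg Subtype.val h
  simp only [coe_symm_eq] at this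
  exact Subtype.ext (by simp [half]; linarith)

/-- The folding map `t ↦ 1 - |1 - 2t|` of the unit interval. -/
def fold (t : I) : I := ⟨1 - |1 - 2 * (t : ℝ)|, by
  have := t.2.1; have := t.2.2
  constructor
  · have : |1 - 2 * (t : ℝ)| ≤ 1 := abs_le.2 ⟨by linarith, by linarith⟩
    linarith
  · have := abs_nonneg (1 - 2 * (t : ℝ))
    linarith⟩

theorem fold_eq_fold_iff {s t : I} : fold s = fold t ↔ s = t ∨ s = σ t := by
  simp only [fold, Subtype.ext_iff, coe_symm_eq]
  constructor
  · intro h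
    rcases abs_eq_abs.1 (show |1 - 2 * (s : ℝ)| = |1 - 2 * (t : ℝ)| by linarith) with h | h
    · left; linarith
    · right; linarith
  · rintro (h | h)
    · rw [h]
    · rw [h, show 1 - 2 * (1 - (t : ℝ)) = -(1 - 2 * t) by ring, abs_neg]

theorem fold_symm (t : I) : fold (σ t) = fold t := fold_eq_fold_iff.2 (.inr rfl)

theorem fold_eq_one_iff {t : I} : fold t = 1 ↔ t = half := by
  have h1 : fold half = 1 := Subtype.ext (by simp [fold, half])
  rw [← h1, fold_eq_fold_iff, symm_half, or_self]

namespace Cut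

variable (c : Cut A Y)

theorem regluing_side_eq (P : Pu) (t : I) : c.regluing (c.side P t) = A.arc P (fold t) :=
  c.regluing_side P _ t rfl

theorem regluing_side_symm (P : Pu) (t : I) :
    c.regluing (c.side P (σ t)) = c.regluing (c.side P t) := by
  rw [regluing_side_eq, regluing_side_eq, fold_symm]

/-- The point of the sheet `Σ⁺` of the cover given by a point of the cut surface. -/
def upper (y : Y) : c.Cover := Quot.mk _ (Sum.inl y)

/-- The involution of the cover that exchanges the two sheets. -/
def swap : C(c.Cover, c.Cover) where
  toFun := Quot.lift (fun z => Quot.mk _ z.swap) (by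
    rintro _ _ ⟨P, t⟩
    have := Quot.sound (Glue.mk (c := c) P (σ t))
    rw [symm_symm] at this
    exact this.symm)
  continuous_toFun := continuous_quot_lift _ (continuous_quot_mk.comp continuous_sum_swap)

theorem continuous_upper : Continuous c.upper := continuous_quot_mk.comp continuous_inl

@[simp] theorem proj_upper (y : Y) : c.proj (c.upper y) = c.regluing y := rfl

theorem swap_swap (a : c.Cover) : c.swap (c.swap a) = a := by
  obtain ⟨y | y⟩ := a <;> rfl

@[simp] theorem proj_swap (a : c.Cover) : c.proj (c.swap a) = c.proj a := by
  obtain ⟨y | y⟩ := a <;> rfl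

theorem exists_upper (a : c.Cover) : ∃ y, a = c.upper y ∨ a = c.swap (c.upper y) := by
  obtain ⟨y | y⟩ := a
  · exact ⟨y, .inl rfl⟩
  · exact ⟨y, .inr rfl⟩

theorem upper_side (P : Pu) (t : I) : c.upper (c.side P t) = c.swap (c.upper (c.side P (σ t))) :=
  Quot.sound (Glue.mk P t)

/-- Each fold of a segment amounts to a change of sheet in the cover, so a chain of folds is tracked
by its parity. This is why the fibres of `proj` are the orbits of `swap`. -/
theorem upper_eq_or_of_eqvGen {y y' : Y} (h : Relation.EqvGen (Fold c.side) y y') :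
    c.upper y' = c.upper y ∨ c.upper y' = c.swap (c.upper y) := by
  induction h with
  | rel y y' h =>
    obtain ⟨P, t⟩ := h
    right
    rw [c.upper_side P t, swap_swap]
  | refl y => exact .inl rfl
  | symm y y' _ ih =>
    rcases ih with ih | ih
    · exact .inl ih.symm
    · right; rw [ih, swap_swap]
  | trans y y' y'' _ _ ih ih' =>
    rcases ih with ih | ih <;> rcases ih' with ih' | ih' <;> rw [ih', ih]
    · exact .inl rfl
    · exact .inr rfl
    · exact .inr rfl
    · rw [swap_swap]; exact .inl rfl

theorem eq_or_eq_swap_of_proj_eq {a b : c.Cover} (h : c.proj a = c.proj b) :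
    b = a ∨ b = c.swap a := by
  obtain ⟨y, hy⟩ := c.exists_upper a
  obtain ⟨y', hy'⟩ := c.exists_upper b
  have hq : c.regluing y = c.regluing y' := by
    rcases hy with rfl | rfl <;> rcases hy' with rfl | rfl <;> simpa using h
  have := c.upper_eq_or_of_eqvGen ((c.regluing_eq_iff _ _).1 hq)
  rcases hy with rfl | rfl <;> rcases hy' with rfl | rfl <;> rcases this with e | e <;>
    simp [e, swap_swap]

/-- The point of the cover over a puncture. -/
noncomputable def cone (P : Pu) : c.Cover := c.upper (c.side P half)

theorem regluing_side_half (P : Pu) : c.regluing (c.side P half) = P := by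
  rw [regluing_side_eq, fold_eq_one_iff.2 rfl, A.arc_one]

@[simp] theorem proj_cone (P : Pu) : c.proj (c.cone P) = P := c.regluing_side_half P

/-- The midpoint of a segment is fixed by `σ`, so the gluing identifies its two copies: here the
cover branches. -/
theorem swap_cone (P : Pu) : c.swap (c.cone P) = c.cone P := by
  have := c.upper_side P half
  rw [symm_half] at this
  exact this.symm

theorem eq_cone_of_proj_eq {P : Pu} {a : c.Cover} (h : c.proj a = P) : a = c.cone P := by
  rcases c.eq_or_eq_swap_of_proj_eq (a := c.cone P) (b := a) (by simp [h]) with e | e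
  · exact e
  · rw [e, swap_cone]

theorem proj_surjective : Function.Surjective c.proj := fun x => by
  obtain ⟨y, rfl⟩ := c.surjective x
  exact ⟨c.upper y, rfl⟩

instance [CompactSpace Y] : CompactSpace c.Cover :=
  inferInstanceAs (CompactSpace (Quot c.Glue))

theorem regluing_side_eq_iff {P : Pu} {s t : I} :
    c.regluing (c.side P s) = c.regluing (c.side P t) ↔ s = t ∨ s = σ t := by
  rw [regluing_side_eq, regluing_side_eq, (A.arc_injective P).eq_iff, fold_eq_fold_iff]

theorem eq_or_exists_side_of_eqvGen {y y' : Y} (h : Relation.EqvGen (Fold c.side) y y') :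
    y = y' ∨ (∃ P t, y = c.side P t) ∧ ∃ P t, y' = c.side P t := by
  induction h with
  | rel y y' h =>
    obtain ⟨P, t⟩ := h
    exact .inr ⟨⟨P, t, rfl⟩, P, σ t, rfl⟩
  | refl y => exact .inl rfl
  | symm y y' _ ih => exact ih.imp Eq.symm And.symm
  | trans y y' y'' _ _ ih ih' =>
    rcases ih with rfl | ih
    · exact ih'
    · rcases ih' with rfl | ih'
      · exact .inr ih
      · exact .inr ⟨ih.1, ih'.2⟩

/-- A point identified with a different one lies on a segment, and each segment meets a fibre in at
most a pair `t`, `σ t`. Several segments can occur, as arcs may share their starting points. -/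
theorem finite_regluing_fiber [Finite Pu] (x : X) : (c.regluing ⁻¹' {x}).Finite := by
  obtain ⟨y₀, hy₀⟩ := c.surjective x
  have hP : ∀ P : Pu, {t | c.regluing (c.side P t) = x}.Finite := fun P => by
    rcases Set.eq_empty_or_nonempty {t | c.regluing (c.side P t) = x} with h | ⟨t₀, ht₀⟩
    · rw [h]; exact Set.finite_empty
    · refine (Set.toFinite {t₀, σ t₀}).subset fun t ht => ?_
      exact c.regluing_side_eq_iff.1 (Eq.trans ht (Eq.symm ht₀))
  refine ((Set.finite_singleton y₀).union (Set.finite_iUnion fun P =>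
    (hP P).image (c.side P))).subset fun y hy => ?_
  rcases c.eq_or_exists_side_of_eqvGen
    ((c.regluing_eq_iff y y₀).1 (Eq.trans hy hy₀.symm)) with rfl | ⟨⟨P, t, rfl⟩, -⟩
  · exact .inl rfl
  · exact .inr (Set.mem_iUnion.2 ⟨P, t, hy, rfl⟩)

variable [T2Space X]

theorem isClosedMap_regluing [CompactSpace Y] : IsClosedMap c.regluing :=
  c.regluing.continuous.isClosedMap

theorem isClosedMap_proj [CompactSpace Y] : IsClosedMap c.proj :=
  c.proj.continuous.isClosedMap

end Cut

end Sheets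

end PuncturedSurface

namespace PuncturedSurface

/-! ### Colourings and the covering property -/

namespace Cut

section Colouring

variable {X : Type*} [TopologicalSpace X] [ChartedSpace (EuclideanHalfSpace 2) X]
  {Pu : Set X} {A : ArcSystem Pu} {Y : Type*} [TopologicalSpace Y]
  [ChartedSpace (EuclideanHalfSpace 2) Y] (c : Cut A Y)

/-- A colouring over `S` is a continuous two-valued function on the part of the cut surface over
`S` that takes different values at the two points of a segment that are glued together. It amounts
to a trivialization of the cover over `S`. -/
structure IsColouring (S : Set X) (col : Y → Bool) : Prop where
  continuousOn : ContinuousOn col (c.regluing ⁻¹' S)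
  symm : ∀ P t, c.regluing (c.side P t) ∈ S → col (c.side P (σ t)) = !col (c.side P t)

variable {c}

open Classical in
/-- A colouring over an open set labels the two sheets of the cover. -/
theorem IsColouring.exists_sheet {S : Set X} (hS : IsOpen S) {col : Y → Bool}
    (h : c.IsColouring S col) :
    ∃ ε : c.Cover → Bool, ContinuousOn ε (c.proj ⁻¹' S) ∧
      (∀ y, c.regluing y ∈ S → ε (c.upper y) = col y) ∧
      ∀ a, c.proj a ∈ S → ε (c.swap a) = !ε a := by
  -- The default `false` off `S` is used on both sheets, so that `g` is compatible with the gluing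
  -- there too.
  let g : Y ⊕ Y → Bool := Sum.elim (fun y => if c.regluing y ∈ S then col y else false)
    (fun y => if c.regluing y ∈ S then !col y else false)
  have hg : ∀ a b, c.Glue a b → g a = g b := by
    rintro _ _ ⟨P, t⟩
    by_cases ht : c.regluing (c.side P t) ∈ S
    · simp [g, c.regluing_side_symm, ht, h.symm P t ht]
    · simp [g, c.regluing_side_symm, ht]
  refine ⟨Quot.lift g hg, ?_, fun y hy => by simp [upper, g, hy], ?_⟩
  · refine (isQuotientMap_quot_mk.continuousOn_isOpen_iff (hS.preimage c.proj.continuous)).2 ?_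
    have hc : ContinuousOn g (Sum.elim c.regluing c.regluing ⁻¹' S) := by
      intro z hz
      have hn := (hS.preimage c.regluing.continuous)
      rcases z with y | y
      · have h1 : ContinuousAt (fun y => if c.regluing y ∈ S then col y else false) y :=
          (h.continuousOn.continuousAt (hn.mem_nhds hz)).congr
            (by filter_upwards [hn.mem_nhds hz] with z hz; exact (if_pos hz).symm)
        refine ContinuousAt.continuousWithinAt ?_
        rw [ContinuousAt, nhds_inl, Filter.tendsto_map'_iff]
        exact h1
      · have h1 : ContinuousAt (fun y => if c.regluing y ∈ S then !col y else false) y :=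
          ((continuous_of_discreteTopology (f := not)).continuousAt.comp
            (h.continuousOn.continuousAt (hn.mem_nhds hz))).congr
            (by filter_upwards [hn.mem_nhds hz] with z hz; exact (if_pos hz).symm)
        refine ContinuousAt.continuousWithinAt ?_
        rw [ContinuousAt, nhds_inr, Filter.tendsto_map'_iff]
        exact h1
    refine hc.mono ?_
    rintro (y | y) hy <;> exact hy
  · intro a ha
    obtain ⟨y | y⟩ := a
    · have hy : c.regluing y ∈ S := ha
      change g (Sum.inr y) = !g (Sum.inl y)
      simp [g, hy]
    · have hy : c.regluing y ∈ S := ha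
      change g (Sum.inl y) = !g (Sum.inr y)
      simp [g, hy]

theorem IsColouring.swap_ne {S : Set X} (hS : IsOpen S) {col : Y → Bool}
    (h : c.IsColouring S col) {a : c.Cover} (ha : c.proj a ∈ S) : c.swap a ≠ a := by
  obtain ⟨ε, -, -, hε⟩ := h.exists_sheet hS
  intro e
  have := hε a ha
  rw [e] at this
  exact Bool.eq_not.1 this rfl |>.elim

/-- Projection and sheet label together form a continuous bijection onto `S × Bool`. It is closed
because `proj` maps a compact space to a Hausdorff one, and hence is a homeomorphism. -/
theorem IsColouring.isEvenlyCovered [T2Space X] [CompactSpace Y] {S : Set X} (hS : IsOpen S)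
    {col : Y → Bool} (h : c.IsColouring S col) {x : X} (hx : x ∈ S) :
    IsEvenlyCovered c.proj x Bool := by
  obtain ⟨ε, hεc, -, hε⟩ := h.exists_sheet hS
  let F : c.proj ⁻¹' S → S × Bool := fun a => (⟨c.proj a, a.2⟩, ε a)
  have hFc : Continuous F := by
    refine Continuous.prodMk (by fun_prop) ?_
    exact continuousOn_iff_continuous_domRestrict.1 hεc
  have hinj : Function.Injective F := by
    rintro ⟨a, ha⟩ ⟨b, hb⟩ hab
    obtain ⟨h1, h2⟩ := Prod.ext_iff.1 hab
    have h1 : c.proj a = c.proj b := congrArg Subtype.val h1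
    have h2 : ε a = ε b := h2
    rcases c.eq_or_eq_swap_of_proj_eq h1 with e | e
    · exact Subtype.ext e.symm
    · rw [e, hε a ha] at h2
      simp at h2
  have hsurj : Function.Surjective F := by
    rintro ⟨⟨x, hx⟩, b⟩
    obtain ⟨a, rfl⟩ := c.proj_surjective x
    by_cases hb : ε a = b
    · exact ⟨⟨a, hx⟩, Prod.ext rfl hb⟩
    · refine ⟨⟨c.swap a, by simpa using hx⟩, Prod.ext (Subtype.ext (c.proj_swap a)) ?_⟩
      change ε (c.swap a) = b
      rw [hε a hx]
      exact (Bool.eq_not.2 (Ne.symm hb)).symm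
  have hclosed : IsClosedMap F := by
    intro C hC
    have hp : IsClosedMap (S.restrictPreimage c.proj) := c.isClosedMap_proj.restrictPreimage S
    have hεS : Continuous fun a : c.proj ⁻¹' S => ε a :=
      continuousOn_iff_continuous_domRestrict.1 hεc
    have : F '' C = ⋃ b : Bool,
        (S.restrictPreimage c.proj '' (C ∩ (fun a : c.proj ⁻¹' S => ε a) ⁻¹' {b})) ×ˢ {b} := by
      ext ⟨x, b⟩
      simp only [Set.mem_image, Set.mem_iUnion, Set.mem_prod, Set.mem_singleton_iff,
        Set.mem_inter_iff, Set.mem_preimage]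
      constructor
      · rintro ⟨a, ha, hab⟩
        obtain ⟨rfl, rfl⟩ := Prod.ext_iff.1 hab
        exact ⟨_, ⟨a, ⟨ha, rfl⟩, rfl⟩, rfl⟩
      · rintro ⟨b', ⟨a, ⟨ha, hb⟩, rfl⟩, rfl⟩
        exact ⟨a, ha, Prod.ext rfl hb⟩
    rw [this]
    exact isClosed_iUnion_of_finite fun b =>
      (hp _ (hC.inter (isClosed_singleton.preimage hεS))).prod isClosed_singleton
  exact ⟨inferInstance, S, hx, hS, hS.preimage c.proj.continuous,
    (Equiv.ofBijective F ⟨hinj, hsurj⟩).toHomeomorphOfContinuousClosed hFc hclosed, fun _ => rfl⟩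

/-- A colouring of a single fibre extends to a neighbourhood. -/
theorem exists_isColouring_of_fiber [T2Space X] [T2Space Y] [CompactSpace Y] [Finite Pu] {x : X}
    {col : Y → Bool}
    (hcol : ∀ P t, c.regluing (c.side P t) = x → col (c.side P (σ t)) = !col (c.side P t)) :
    ∃ S, IsOpen S ∧ x ∈ S ∧ ∃ col', c.IsColouring S col' := by
  classical
  have hfin := c.finite_regluing_fiber x
  obtain ⟨N, N', hNo, hN'o, hN, hN', hd⟩ := SeparatedNhds.of_finite
    (hfin.subset (Set.inter_subset_left (t := {y | col y = true})))
    (hfin.subset (Set.inter_subset_left (t := {y | col y = false})))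
    (by rw [Set.disjoint_left]; rintro y ⟨-, h1⟩ ⟨-, h2⟩
        have h1 : col y = true := h1
        have h2 : col y = false := h2
        simp [h1] at h2)
  -- The parameters at which the two mirror points lie in opposite members of the pair `N`, `N'`.
  let K : Pu → Set I := fun P => {t | (c.side P t ∈ N ∧ c.side P (σ t) ∈ N') ∨
    (c.side P t ∈ N' ∧ c.side P (σ t) ∈ N)}
  have hK : ∀ P, IsOpen (K P) := fun P =>
    ((hNo.preimage (c.side P).continuous).inter
      (hN'o.preimage ((c.side P).continuous.comp continuous_symm))).union
    ((hN'o.preimage (c.side P).continuous).inter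
      (hNo.preimage ((c.side P).continuous.comp continuous_symm)))
  have hxN : ∀ y, c.regluing y = x → y ∈ N ∪ N' := fun y hy => by
    cases hc : col y
    · exact .inr (hN' ⟨hy, hc⟩)
    · exact .inl (hN ⟨hy, hc⟩)
  have hxK : ∀ P t, c.regluing (c.side P t) = x → t ∈ K P := fun P t ht => by
    have ht' : c.regluing (c.side P (σ t)) = x := by rw [c.regluing_side_symm, ht]
    have := hcol P t ht
    cases hc : col (c.side P t) <;> rw [hc] at this
    · exact .inr ⟨hN' ⟨ht, hc⟩, hN ⟨ht', this⟩⟩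
    · exact .inl ⟨hN ⟨ht, hc⟩, hN' ⟨ht', this⟩⟩
  -- Removed from `X` are the image of the points outside `N ∪ N'` and, for each segment, the image
  -- of the parameters outside `K P`. By compactness these sets are closed, and none contains `x`.
  refine ⟨(c.regluing '' (N ∪ N')ᶜ)ᶜ ∩ ⋂ P, ((fun t => c.regluing (c.side P t)) '' (K P)ᶜ)ᶜ,
    ?_, ⟨?_, ?_⟩, fun y => decide (y ∈ N), ?_, ?_⟩
  · refine IsOpen.inter ?_ (isOpen_iInter_of_finite fun P => ?_)
    · exact (c.isClosedMap_regluing _ (hNo.union hN'o).isClosed_compl).isOpen_compl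
    · exact ((hK P).isClosed_compl.isCompact.image (by fun_prop)).isClosed.isOpen_compl
  · rintro ⟨y, hy, hyx⟩
    exact hy (hxN y hyx)
  · refine Set.mem_iInter.2 fun P => ?_
    rintro ⟨t, ht, htx⟩
    exact ht (hxK P t htx)
  · have hsub : ∀ y, c.regluing y ∈ (c.regluing '' (N ∪ N')ᶜ)ᶜ → y ∈ N ∪ N' := fun y hy => by
      by_contra h
      exact hy ⟨y, h, rfl⟩
    intro y hy
    refine ContinuousAt.continuousWithinAt ?_
    rcases hsub y hy.1 with h | h
    · refine continuousAt_const (y := true) |>.congr ?_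
      filter_upwards [hNo.mem_nhds h] with z hz
      simp [hz]
    · refine continuousAt_const (y := false) |>.congr ?_
      filter_upwards [hN'o.mem_nhds h] with z hz
      simp [Set.disjoint_right.1 hd hz]
  · intro P t ht
    have htK : t ∈ K P := by
      by_contra h
      exact Set.mem_iInter.1 ht.2 P ⟨t, h, rfl⟩
    rcases htK with ⟨h1, h2⟩ | ⟨h1, h2⟩
    · simp [h1, Set.disjoint_right.1 hd h2]
    · simp [h2, Set.disjoint_right.1 hd h1]

variable (c) in
/-- `S` is locally coloured if every point of `S` has a neighbourhood with a colouring. -/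
def IsLocallyColoured (S : Set X) : Prop :=
  ∀ x ∈ S, ∃ T, IsOpen T ∧ x ∈ T ∧ ∃ col, c.IsColouring T col

theorem IsLocallyColoured.mono {S T : Set X} (h : c.IsLocallyColoured S) (hT : T ⊆ S) :
    c.IsLocallyColoured T := fun x hx => h x (hT hx)

theorem IsLocallyColoured.swap_ne {S : Set X} (h : c.IsLocallyColoured S) {a : c.Cover}
    (ha : c.proj a ∈ S) : c.swap a ≠ a := by
  obtain ⟨T, hT, hx, col, hcol⟩ := h _ ha
  exact hcol.swap_ne hT hx

theorem IsLocallyColoured.isCoveringMapOn [T2Space X] [CompactSpace Y] {S : Set X}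
    (h : c.IsLocallyColoured S) : IsCoveringMapOn c.proj S := fun x hx => by
  obtain ⟨T, hT, hxT, col, hcol⟩ := h x hx
  exact (hcol.isEvenlyCovered hT hxT).to_isEvenlyCovered_preimage

open Classical in
/-- A section of the cover over an open set yields a colouring. -/
theorem IsLocallyColoured.isColouring_of_section {S : Set X} (hS : IsOpen S)
    (h : c.IsLocallyColoured S) {s : X → c.Cover} (hs : ContinuousOn s S)
    (hp : ∀ x ∈ S, c.proj (s x) = x) :
    c.IsColouring S fun y => decide (c.upper y = s (c.regluing y)) := by
  constructor
  · intro y hy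
    refine ContinuousAt.continuousWithinAt ?_
    obtain ⟨T, hT, hxT, col, hcol⟩ := h _ hy
    obtain ⟨ε, hεc, -, hε⟩ := hcol.exists_sheet hT
    -- Two points of one fibre over `T` coincide exactly if their local labels `ε` agree, and the
    -- labels vary continuously.
    have hcong : (fun y => decide (ε (c.upper y) = ε (s (c.regluing y)))) =ᶠ[𝓝 y]
        fun y => decide (c.upper y = s (c.regluing y)) := by
      filter_upwards [((hS.inter hT).preimage c.regluing.continuous).mem_nhds ⟨hy, hxT⟩]
        with z hz
      refine decide_eq_decide.2 ⟨fun e => ?_, fun e => by rw [e]⟩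
      rcases c.eq_or_eq_swap_of_proj_eq (a := c.upper z) (b := s (c.regluing z))
        (by simp [hp _ hz.1]) with e' | e'
      · exact e'.symm
      · rw [e', hε _ hz.2] at e
        simp at e
    refine ContinuousAt.congr ?_ hcong
    have h1 : ContinuousAt (fun y => ε (c.upper y)) y :=
      ContinuousAt.comp (f := c.upper) (hεc.continuousAt
        ((hT.preimage c.proj.continuous).mem_nhds hxT)) c.continuous_upper.continuousAt
    have h2 : ContinuousAt (fun y => s (c.regluing y)) y :=
      ContinuousAt.comp (f := c.regluing) (hs.continuousAt (hS.mem_nhds hy))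
        c.regluing.continuous.continuousAt
    have h3 : ContinuousAt (fun y => ε (s (c.regluing y))) y :=
      ContinuousAt.comp (f := fun y => s (c.regluing y)) (hεc.continuousAt
        ((hT.preimage c.proj.continuous).mem_nhds (by
          change c.proj (s (c.regluing y)) ∈ T
          rw [hp _ hy]; exact hxT))) h2
    exact (continuous_of_discreteTopology (f := fun b : Bool × Bool => decide (b.1 = b.2)))
      |>.continuousAt.comp (h1.prodMk h3)
  · intro P t ht
    have hne := h.swap_ne (a := c.upper (c.side P t)) ht
    have hu : c.upper (c.side P (σ t)) = c.swap (c.upper (c.side P t)) := by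
      rw [c.upper_side P t, c.swap_swap]
    rw [hu, c.regluing_side_symm]
    rcases c.eq_or_eq_swap_of_proj_eq (a := c.upper (c.side P t))
      (b := s (c.regluing (c.side P t))) (by simp [hp _ ht]) with e | e
    · simp [e, hne]
    · simp [e, hne.symm]

/-- A colouring over a punctured neighbourhood of a point yields a colouring of its fibre. -/
theorem IsColouring.exists_fiber [T2Space Y] [Finite Pu] {x : X} {U : Set X} (hU : U ∈ 𝓝 x)
    {col : Y → Bool} (h : c.IsColouring (U \ {x}) col) :
    ∃ col' : Y → Bool, ∀ P t, c.regluing (c.side P t) = x →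
      col' (c.side P (σ t)) = !col' (c.side P t) := by
  -- The colour has a limit `k` at each boundary point `v` over `x`: a small punctured half-disc at
  -- `v` is connected and avoids the rest of the finite fibre.
  have key : ∀ v, ∃ k, v ∈ (𝓡∂ 2).boundary Y → c.regluing v = x →
      ∀ᶠ y in 𝓝[≠] v, col y = k ∧ c.regluing y ∈ U \ {x} := by
    intro v
    by_cases hv : v ∈ (𝓡∂ 2).boundary Y ∧ c.regluing v = x
    swap
    · exact ⟨true, fun h1 h2 => (hv ⟨h1, h2⟩).elim⟩
    obtain ⟨hvb, hvx⟩ := hv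
    have hN : c.regluing ⁻¹' U ∩ (c.regluing ⁻¹' {x} \ {v})ᶜ ∈ 𝓝 v := by
      refine Filter.inter_mem (c.regluing.continuous.continuousAt.preimage_mem_nhds (by rwa [hvx]))
        (IsOpen.mem_nhds ?_ fun h => h.2 rfl)
      exact ((c.finite_regluing_fiber x).subset Set.sdiff_subset).isClosed.isOpen_compl
    obtain ⟨W, hWo, hvW, hWN, hW⟩ := exists_contractible_punctured_nhd hvb hN
    have hsub : ∀ y ∈ W \ {v}, c.regluing y ∈ U \ {x} := fun y hy =>
      ⟨(hWN hy.1).1, fun e => (hWN hy.1).2 ⟨e, hy.2⟩⟩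
    have hpre : IsPreconnected (W \ {v}) := isPreconnected_iff_preconnectedSpace.2 inferInstance
    obtain ⟨y₀⟩ : Nonempty ↥(W \ {v}) := inferInstance
    refine ⟨col y₀, fun _ _ => ?_⟩
    filter_upwards [mem_nhdsWithin_of_mem_nhds (hWo.mem_nhds hvW), self_mem_nhdsWithin]
      with y hy hyv
    exact ⟨hpre.constant (h.continuousOn.mono hsub) ⟨hy, hyv⟩ y₀.2, hsub y ⟨hy, hyv⟩⟩
  choose k hk using key
  refine ⟨k, fun P t ht => ?_⟩
  have h1 : Filter.Tendsto (c.side P) (𝓝[≠] t) (𝓝[≠] (c.side P t)) :=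
    tendsto_nhdsWithin_of_tendsto_nhds_of_eventually_within _
      ((c.side P).continuous.continuousAt.tendsto.mono_left nhdsWithin_le_nhds)
      (by filter_upwards [self_mem_nhdsWithin] with s hs e
          exact hs (c.side_injective P e))
  have h2 : Filter.Tendsto (fun s => c.side P (σ s)) (𝓝[≠] t) (𝓝[≠] (c.side P (σ t))) :=
    tendsto_nhdsWithin_of_tendsto_nhds_of_eventually_within _
      (((c.side P).continuous.comp continuous_symm).continuousAt.tendsto.mono_left
        nhdsWithin_le_nhds)
      (by filter_upwards [self_mem_nhdsWithin] with s hs e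
          exact hs (symm_bijective.injective (c.side_injective P e)))
  -- At a parameter `s ≠ t` close to `t`, the colours at `s` and `σ s` already equal the limits, and
  -- they are opposite.
  obtain ⟨s, ⟨hs1, hs2⟩, hs3, -⟩ := ((h1.eventually (hk _ (c.side_boundary P t) ht)).and
    (h2.eventually (hk _ (c.side_boundary P (σ t)) (by rw [c.regluing_side_symm, ht])))).exists
  rw [← hs1, ← hs3, h.symm P s hs2]

/-- No punctured neighbourhood of a puncture has a colouring. -/
theorem not_isColouring_punctured [T2Space Y] [Finite Pu] {P : Pu} {U : Set X} (hU : U ∈ 𝓝 (P : X))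
    (col : Y → Bool) : ¬ c.IsColouring (U \ {(P : X)}) col := fun h => by
  obtain ⟨col', h'⟩ := h.exists_fiber hU
  -- The midpoint is its own mirror image, so its colour would equal its negation.
  have := h' P half (c.regluing_side_half P)
  rw [symm_half] at this
  simp at this

/-- The starting points of the arcs. -/
def arcStarts (A : ArcSystem Pu) : Set X := Set.range fun P => A.arc P 0

/-- Here a fibre meets at most one segment, and then in two distinct points `t` and `σ t`, which can
be coloured differently. A fibre that meets no segment is unconstrained. -/
theorem isLocallyColoured_compl_arcStarts [T2Space X] [T2Space Y] [CompactSpace Y] [Finite Pu] :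
    c.IsLocallyColoured (Pu ∪ arcStarts A)ᶜ := fun x hx => by
  classical
  by_cases h : ∃ P t, c.regluing (c.side P t) = x
  · obtain ⟨P, t, ht⟩ := h
    refine exists_isColouring_of_fiber (col := fun y => decide (y = c.side P t)) fun Q u hu => ?_
    have harc := hu.trans ht.symm
    rw [regluing_side_eq, regluing_side_eq] at harc
    have hQ : Q = P := by
      by_contra hne
      obtain ⟨-, h0⟩ := A.arc_disjoint Q P _ _ hne harc
      refine hx (.inr ⟨P, ?_⟩)
      rw [← ht, regluing_side_eq, h0]
    subst hQ
    have hth : t ≠ σ t := fun e => hx (.inl (by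
      rw [← ht, eq_half_of_symm_eq e.symm, c.regluing_side_half]; exact Q.2))
    rcases fold_eq_fold_iff.1 (A.arc_injective Q harc) with rfl | rfl
    · simp [(c.side_injective Q).eq_iff, hth.symm]
    · simp [(c.side_injective Q).eq_iff, hth.symm]
  · exact exists_isColouring_of_fiber (col := fun _ => true)
      fun P t ht => (h ⟨P, t, ht⟩).elim

/-- At an arc start many segments may meet the fibre, and no choice of colours is evident. But a
punctured half-disc around it is simply connected and avoids the other exceptional points, so the
cover has a section there; the resulting colouring has limits on the fibre, which colour it
consistently. -/
theorem isLocallyColoured_compl [T2Space X] [T2Space Y] [CompactSpace Y] [Finite Pu] :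
    c.IsLocallyColoured Puᶜ := fun b hb => by
  classical
  by_cases hbs : b ∈ arcStarts A
  swap
  · exact isLocallyColoured_compl_arcStarts b fun h => h.elim hb hbs
  obtain ⟨P, hP⟩ := hbs
  have hbd : b ∈ (𝓡∂ 2).boundary X := hP ▸ A.arc_zero P
  have hfin : ((Pu ∪ arcStarts A) \ {b}).Finite :=
    ((Set.toFinite Pu).union (Set.finite_range _)).subset Set.sdiff_subset
  obtain ⟨W, hWo, hbW, hWN, hW⟩ := exists_contractible_punctured_nhd hbd
    (hfin.isClosed.isOpen_compl.mem_nhds (fun h => h.2 rfl))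
  have hWo' : IsOpen (W \ {b}) := hWo.sdiff isClosed_singleton
  have hsub : W \ {b} ⊆ (Pu ∪ arcStarts A)ᶜ := fun x hx h => hWN hx.1 ⟨h, hx.2⟩
  have hloc := (isLocallyColoured_compl_arcStarts (c := c)).mono hsub
  have : LocallyPathConnectedSpace X :=
    ChartedSpace.locallyPathConnectedSpace (EuclideanHalfSpace 2) X
  have : LocallyPathConnectedSpace ↥(W \ {b}) := hWo'.locallyPathConnectedSpace
  obtain ⟨w₀⟩ : Nonempty ↥(W \ {b}) := inferInstance
  obtain ⟨a₀, ha₀⟩ := c.proj_surjective w₀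
  obtain ⟨F, ⟨-, hF⟩, -⟩ := hloc.isCoveringMapOn.existsUnique_continuousMap_lifts
    ⟨Subtype.val, continuous_subtype_val⟩ (a₀ := w₀) ha₀ fun w => w.2
  let s : X → c.Cover := fun x => if h : x ∈ W \ {b} then F ⟨x, h⟩ else a₀
  have hs : ∀ w : ↥(W \ {b}), s w = F w := fun w => dif_pos w.2
  have hcol := hloc.isColouring_of_section hWo' (s := s)
    (continuousOn_iff_continuous_domRestrict.2 (F.continuous.congr fun w => (hs w).symm))
    (fun x hx => (congrArg c.proj (hs ⟨x, hx⟩)).trans (congrFun hF ⟨x, hx⟩))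
  obtain ⟨col', h'⟩ := hcol.exists_fiber (hWo.mem_nhds hbW)
  exact exists_isColouring_of_fiber h'

end Colouring

/-! ### The covering over the complement of the punctures, and Hausdorffness of the cover -/

section Regular

variable {X : Type*} [TopologicalSpace X] [ChartedSpace (EuclideanHalfSpace 2) X]
  {Pu : Set X} {A : ArcSystem Pu} {Y : Type*} [TopologicalSpace Y]
  [ChartedSpace (EuclideanHalfSpace 2) Y] (c : Cut A Y)
  [T2Space X] [T2Space Y] [CompactSpace Y] [Finite Pu]

theorem isCoveringMap_projRegular : IsCoveringMap c.projRegular :=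
  (isLocallyColoured_compl (c := c)).isCoveringMapOn.isCoveringMap_restrictPreimage

theorem swap_ne (a : c.regular) : c.swap a.1 ≠ a.1 :=
  isLocallyColoured_compl.swap_ne a.2

/-- Points with different projections are separated in `X`. Distinct points of one fibre lie over a
regular point, since the fibre of a puncture is a single point, and are separated by local sheet
labels. -/
instance : T2Space c.Cover := ⟨fun a b hab => by
  by_cases h : c.proj a = c.proj b
  · have ha : c.proj a ∈ Puᶜ := fun hP => hab <| by
      rw [c.eq_cone_of_proj_eq (P := ⟨_, hP⟩) (a := a) rfl,
        c.eq_cone_of_proj_eq (P := ⟨_, hP⟩) (a := b) h.symm]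
    obtain ⟨T, hT, haT, col, hcol⟩ := isLocallyColoured_compl (c := c) _ ha
    obtain ⟨ε, hεc, -, hε⟩ := hcol.exists_sheet hT
    have hTo := hT.preimage c.proj.continuous
    refine ⟨c.proj ⁻¹' T ∩ ε ⁻¹' {ε a}, c.proj ⁻¹' T ∩ ε ⁻¹' {ε b},
      hεc.isOpen_inter_preimage hTo (isOpen_discrete _),
      hεc.isOpen_inter_preimage hTo (isOpen_discrete _), ⟨haT, rfl⟩,
      ⟨by rw [Set.mem_preimage, ← h]; exact haT, rfl⟩, Set.disjoint_left.2 ?_⟩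
    rintro z ⟨-, h1⟩ ⟨-, h2⟩
    have h12 : ε a = ε b := (Eq.symm h1).trans h2
    rcases c.eq_or_eq_swap_of_proj_eq h with e | e
    · exact hab e.symm
    · rw [e, hε a haT] at h12
      simp at h12
  · exact separated_by_continuous c.proj.continuous h⟩

end Regular

end Cut

end PuncturedSurface

namespace PuncturedSurface

/-! ### The cover over a disc around a puncture -/

/-- The exponential of the projection of `z` to the half-plane `re z ≤ 0`. -/
noncomputable def clampExp (z : ℂ) : ℂ := Complex.exp ⟨min z.re 0, z.im⟩

theorem clampExp_ne_zero (z : ℂ) : clampExp z ≠ 0 := Complex.exp_ne_zero _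

theorem continuous_clampExp : Continuous clampExp := by
  have : clampExp = fun z => Complex.exp ((min z.re 0 : ℝ) + z.im * Complex.I) :=
    funext fun z => congrArg Complex.exp (Complex.ext (by simp) (by simp))
  rw [this]
  fun_prop

theorem norm_clampExp (z : ℂ) : ‖clampExp z‖ = Real.exp (min z.re 0) := by
  rw [clampExp, Complex.norm_exp]

theorem clampExp_mem (z : ℂ) : clampExp z ∈ Metric.closedBall (0 : ℂ) 1 := by
  simp [norm_clampExp]

theorem clampExp_of_re_le {z : ℂ} (hz : z.re ≤ 0) : clampExp z = Complex.exp z := by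
  rw [clampExp, min_eq_left hz]

theorem clampExp_add_two_pi_mul (z : ℂ) (n : ℤ) :
    clampExp (z + n * (2 * Real.pi * Complex.I)) = clampExp z := by
  have : (⟨min (z + n * (2 * Real.pi * Complex.I)).re 0,
      (z + n * (2 * Real.pi * Complex.I)).im⟩ : ℂ)
      = ⟨min z.re 0, z.im⟩ + n * (2 * Real.pi * Complex.I) := by
    apply Complex.ext <;> simp
  rw [clampExp, this, Complex.exp_periodic.int_mul n, clampExp]

/-- A continuous `2πi`-periodic function of a logarithm of a non-zero number is continuous. -/
theorem continuous_comp_log {T : Type*} [TopologicalSpace T] {F : ℂ → T} (hF : Continuous F)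
    (hper : Function.Periodic F (2 * Real.pi * Complex.I)) :
    Continuous fun w : {w : ℂ // w ≠ 0} => F (Complex.log w) := by
  have hq : IsQuotientMap fun z : ℂ => (⟨_, z.exp_ne_zero⟩ : {w : ℂ // w ≠ 0}) :=
    Complex.isCoveringMap_exp.isQuotientMap fun w => ⟨Complex.log w, Subtype.ext
      (Complex.exp_log w.2)⟩
  rw [hq.continuous_iff]
  refine hF.congr fun z => ?_
  obtain ⟨n, hn⟩ := Complex.exp_eq_exp_iff_exists_int.1 (Complex.exp_log z.exp_ne_zero)
  simp only [Function.comp_apply]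
  rw [hn, hper.int_mul n]

theorem comp_log_exp {T : Type*} {F : ℂ → T}
    (hper : Function.Periodic F (2 * Real.pi * Complex.I)) (z : ℂ) :
    F (Complex.log (Complex.exp z)) = F z := by
  obtain ⟨n, hn⟩ := Complex.exp_eq_exp_iff_exists_int.1 (Complex.exp_log z.exp_ne_zero)
  rw [hn, hper.int_mul n]

namespace PunctureDisc

variable {X : Type*} [TopologicalSpace X] {Pu : Set X} (D : PunctureDisc Pu)

/-- The puncture at the centre of the disc. -/
noncomputable def center : Pu := ⟨D.chart 0, D.center_mem⟩

/-- The closed disc as a subset of the surface. -/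
def disc : Set X := D.chart '' Metric.closedBall 0 1

/-- Logarithmic polar coordinates on the closed disc, constant in the radial direction outside
the closed disc. -/
noncomputable def polar : C(ℂ, (Puᶜ : Set X)) where
  toFun z := ⟨D.chart (clampExp z), fun h =>
    clampExp_ne_zero z (D.eq_center _ (clampExp_mem z) h)⟩
  continuous_toFun := Continuous.subtype_mk (D.chart.continuousOn.comp_continuous
    continuous_clampExp fun z => D.closedBall_subset (clampExp_mem z)) _

theorem polar_coe (z : ℂ) : (D.polar z : X) = D.chart (clampExp z) := rfl

theorem polar_mem (z : ℂ) : (D.polar z : X) ∈ D.disc := ⟨_, clampExp_mem z, rfl⟩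

theorem polar_add_two_pi_mul (z : ℂ) (n : ℤ) :
    D.polar (z + n * (2 * Real.pi * Complex.I)) = D.polar z :=
  Subtype.ext (by simp only [polar_coe, clampExp_add_two_pi_mul])

theorem exists_polar_eq {x : X} (hx : x ∈ D.disc) (hP : x ≠ D.center) :
    ∃ z : ℂ, z.re ≤ 0 ∧ (D.polar z : X) = x := by
  obtain ⟨w, hw, rfl⟩ := hx
  have hw0 : w ≠ 0 := fun h => hP (by rw [h]; rfl)
  have hre : (Complex.log w).re ≤ 0 := by
    rw [Complex.log_re]
    exact Real.log_nonpos (norm_nonneg _) (by simpa using hw)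
  exact ⟨Complex.log w, hre, by rw [polar_coe, clampExp_of_re_le hre, Complex.exp_log hw0]⟩

end PunctureDisc

namespace Cut

variable {X : Type*} [TopologicalSpace X] [ChartedSpace (EuclideanHalfSpace 2) X]
  {Pu : Set X} {A : ArcSystem Pu} {Y : Type*} [TopologicalSpace Y]
  [ChartedSpace (EuclideanHalfSpace 2) Y] (c : Cut A Y)

/-- The involution of the regular part of the cover. -/
def swapRegular : C(c.regular, c.regular) where
  toFun a := ⟨c.swap a, by
    change c.proj (c.swap a) ∈ Puᶜ
    rw [proj_swap]; exact a.2⟩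
  continuous_toFun := by fun_prop

theorem swapRegular_swapRegular (a : c.regular) : c.swapRegular (c.swapRegular a) = a :=
  Subtype.ext (c.swap_swap a)

theorem projRegular_swapRegular (a : c.regular) :
    c.projRegular (c.swapRegular a) = c.projRegular a :=
  Subtype.ext (c.proj_swap a)

theorem eq_or_eq_swapRegular {a b : c.regular} (h : c.projRegular a = c.projRegular b) :
    b = a ∨ b = c.swapRegular a := by
  rcases c.eq_or_eq_swap_of_proj_eq (congrArg Subtype.val h) with e | e
  · exact .inl (Subtype.ext e)
  · exact .inr (Subtype.ext e)

/-! ### Lifting polar coordinates around a puncture -/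

section Lift

variable [T2Space X] [T2Space Y] [CompactSpace Y] [Finite Pu] {c} {D : PunctureDisc Pu}

theorem swapRegular_ne (a : c.regular) : c.swapRegular a ≠ a := fun h =>
  c.swap_ne a (congrArg Subtype.val h)

/-- Clamping has made polar coordinates a map on the whole plane, which is simply connected, so they
lift to the covering. -/
theorem exists_lift_polar {a : c.regular} {z₀ : ℂ} (h : c.projRegular a = D.polar z₀) :
    ∃ s : C(ℂ, c.regular), s z₀ = a ∧ ∀ z, c.projRegular (s z) = D.polar z := by
  obtain ⟨s, ⟨h1, h2⟩, -⟩ := c.isCoveringMap_projRegular.existsUnique_continuousMap_lifts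
    D.polar z₀ a h
  exact ⟨s, h1, congrFun h2⟩

variable {s : C(ℂ, c.regular)} (hs : ∀ z, c.projRegular (s z) = D.polar z)
include hs

/-- Running once around a puncture exchanges the two sheets. -/
theorem lift_add_two_pi (z : ℂ) : s (z + 2 * Real.pi * Complex.I) = c.swapRegular (s z) := by
  have hper : ∀ z, D.polar (z + 2 * Real.pi * Complex.I) = D.polar z := fun z => by
    simpa using D.polar_add_two_pi_mul z 1
  rcases c.eq_or_eq_swapRegular (a := s z) (b := s (z + 2 * Real.pi * Complex.I))
    (by rw [hs, hs, hper]) with h | h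
  swap
  · exact h
  -- If one value repeats after a full turn, uniqueness of lifts makes `s` periodic with period
  -- `2πi`. It then descends along the exponential to a section over the punctured disc, which would
  -- give a forbidden colouring.
  exfalso
  have hall : Function.Periodic s (2 * Real.pi * Complex.I) := by
    refine congrFun (c.isCoveringMap_projRegular.eq_of_comp_eq
      (g₁ := fun z => s (z + 2 * Real.pi * Complex.I)) (g₂ := s) (by fun_prop) s.continuous
      (funext fun z => ?_) z h)
    simp only [Function.comp_apply, hs, hper]
  have hlog := continuous_comp_log s.continuous hall
  have hmaps : Set.MapsTo D.chart.symm (D.chart '' Metric.ball 0 1) D.chart.source := by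
    rintro _ ⟨w, hw, rfl⟩
    exact D.chart.map_target (D.chart.map_source
      (D.closedBall_subset (Metric.ball_subset_closedBall hw)))
  have hsrc : Metric.ball (0 : ℂ) 1 ⊆ D.chart.source :=
    Metric.ball_subset_closedBall.trans D.closedBall_subset
  have hopen : IsOpen (D.chart '' Metric.ball 0 1) :=
    D.chart.isOpen_image_of_subset_source Metric.isOpen_ball hsrc
  have hS : D.chart '' Metric.ball 0 1 \ {(D.center : X)} ⊆ Puᶜ := by
    rintro _ ⟨⟨w, hw, rfl⟩, hne⟩ hP
    exact hne (by rw [D.eq_center w (Metric.ball_subset_closedBall hw) hP]; rfl)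
  have hne0 : ∀ x ∈ D.chart '' Metric.ball 0 1 \ {(D.center : X)}, D.chart.symm x ≠ 0 := by
    rintro _ ⟨⟨w, hw, rfl⟩, hne⟩ h0
    rw [D.chart.left_inv (hsrc hw)] at h0
    exact hne (by rw [h0]; rfl)
  refine not_isColouring_punctured (c := c) (P := D.center)
    (hopen.mem_nhds ⟨0, by simp, rfl⟩) _ (((isLocallyColoured_compl (c := c)).mono hS
    |>.isColouring_of_section (hopen.sdiff isClosed_singleton)
    (s := fun x => (s (Complex.log (D.chart.symm x))).1) ?_) ?_)
  · rw [continuousOn_iff_continuous_domRestrict]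
    have h1 : Continuous fun x : ↥(D.chart '' Metric.ball 0 1 \ {(D.center : X)}) =>
        (⟨D.chart.symm x, hne0 x x.2⟩ : {w : ℂ // w ≠ 0}) := by
      refine Continuous.subtype_mk ?_ _
      refine D.chart.symm.continuousOn.comp_continuous continuous_subtype_val fun x => ?_
      obtain ⟨w, hw, hwx⟩ := x.2.1
      rw [← hwx]
      exact D.chart.map_source (hsrc hw)
    exact continuous_subtype_val.comp (hlog.comp h1)
  · intro x hx
    have h0 := hne0 x hx
    obtain ⟨⟨w, hw, rfl⟩, hne⟩ := hx
    rw [D.chart.left_inv (hsrc hw)] at h0 ⊢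
    have hre : (Complex.log w).re ≤ 0 := by
      rw [Complex.log_re]
      exact Real.log_nonpos (norm_nonneg _) (by simpa using (Metric.ball_subset_closedBall hw))
    change ((c.projRegular (s (Complex.log w))) : X) = _
    rw [hs, D.polar_coe, clampExp_of_re_le hre, Complex.exp_log h0]

theorem lift_periodic : Function.Periodic s (2 * (2 * Real.pi * Complex.I)) := fun z => by
  rw [two_mul, ← add_assoc, lift_add_two_pi hs, lift_add_two_pi hs, swapRegular_swapRegular]

open Classical in
/-- The cover over a disc is a disc: a lift of polar coordinates yields a map from the plane, which
is a two-fold branched cover of the disc in suitable coordinates. -/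
theorem exists_branched_disc : ∃ f : C(ℂ, c.Cover), (∀ z, f (Complex.exp (z / 2)) = s z) ∧
    f 0 = c.cone D.center ∧ Set.InjOn f (Metric.closedBall 0 1) ∧
    f '' Metric.closedBall 0 1 = c.proj ⁻¹' D.disc := by
  have hper : Function.Periodic (fun z => (s (2 * z)).1) (2 * Real.pi * Complex.I) := fun z => by
    simp only [mul_add, lift_periodic hs _]
  -- The lift has period `4πi`, so `s (2 * log w)` does not depend on the branch of the logarithm:
  -- two turns downstairs become one turn of `w`.
  let f : ℂ → c.Cover := fun w => if w = 0 then c.cone D.center else (s (2 * Complex.log w)).1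
  have hf0 : f 0 = c.cone D.center := if_pos rfl
  have hf : ∀ w ≠ 0, f w = s (2 * Complex.log w) := fun w hw => if_neg hw
  have hexp : ∀ z, f (Complex.exp (z / 2)) = s z := fun z => by
    rw [hf _ (Complex.exp_ne_zero _), comp_log_exp hper, mul_div_cancel₀ _ two_ne_zero]
  have hpolar : ∀ z, c.proj (s z) = D.chart (clampExp z) := fun z =>
    congrArg Subtype.val (hs z)
  have hcont : Continuous f := by
    rw [continuous_iff_continuousAt]
    intro w
    by_cases hw : w = 0
    · subst hw
      -- Continuity at the origin: `proj` is closed and the fibre of the puncture is one point, so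
      -- preimages of neighbourhoods of the puncture are arbitrarily small neighbourhoods of that
      -- point.
      have hsing : ∀ N ∈ 𝓝 (f 0), f ⁻¹' N ∈ 𝓝 0 := fun N hN => by
        have hfib : c.proj ⁻¹' {(D.center : X)} = {c.cone D.center} :=
          Set.eq_singleton_iff_unique_mem.2 ⟨by simp, fun a ha => c.eq_cone_of_proj_eq ha⟩
        have hN' : N ∈ 𝓝ˢ (c.proj ⁻¹' {(D.center : X)}) := by
          rw [hfib, nhdsSet_singleton, ← hf0]; exact hN
        obtain ⟨V, hV, hVN⟩ := isClosedMap_iff_comap_nhds_le.1 c.isClosedMap_proj hN'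
        have h0 : ContinuousAt D.chart 0 := D.chart.continuousAt (D.closedBall_subset (by simp))
        obtain ⟨r, hr, hrV⟩ := Metric.mem_nhds_iff.1 (h0.preimage_mem_nhds hV)
        refine Metric.mem_nhds_iff.2 ⟨min r 1, by positivity, fun w hw => hVN ?_⟩
        have hwn : ‖w‖ < min r 1 := by simpa using hw
        by_cases hw0 : w = 0
        · rw [hw0, Set.mem_preimage, hf0, c.proj_cone]
          exact mem_of_mem_nhds hV
        rw [Set.mem_preimage, hf w hw0, hpolar]
        refine hrV ?_
        have hre : (2 * Complex.log w).re ≤ 0 := by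
          have := Real.log_nonpos (norm_nonneg w) (hwn.le.trans (min_le_right _ _))
          simp [Complex.log_re]
          linarith
        rw [clampExp_of_re_le hre, two_mul, Complex.exp_add, Complex.exp_log hw0]
        simp only [Metric.mem_ball, dist_zero_right, norm_mul]
        have h1 := hwn.trans_le (min_le_left _ _)
        have h2 := hwn.trans_le (min_le_right _ _)
        nlinarith [norm_nonneg w]
      exact hsing
    · have hlog := continuous_comp_log (F := fun z => (s (2 * z)).1) (by fun_prop) hper
      have hon : ContinuousOn f {w : ℂ | w ≠ 0} :=
        continuousOn_iff_continuous_domRestrict.2 (hlog.congr fun w => (hf w w.2).symm)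
      exact hon.continuousAt (isOpen_ne.mem_nhds hw)
  have hproj : ∀ w ∈ Metric.closedBall (0 : ℂ) 1, c.proj (f w) = D.chart (w ^ 2) := fun w hw => by
    by_cases hw0 : w = 0
    · rw [hw0, hf0, c.proj_cone]
      simp [PunctureDisc.center]
    have hre : (2 * Complex.log w).re ≤ 0 := by
      have := Real.log_nonpos (norm_nonneg w) (by simpa using hw)
      simp [Complex.log_re]
      linarith
    rw [hf w hw0, hpolar, clampExp_of_re_le hre, two_mul, Complex.exp_add, Complex.exp_log hw0, sq]
  have hsq : ∀ w ∈ Metric.closedBall (0 : ℂ) 1, w ^ 2 ∈ Metric.closedBall (0 : ℂ) 1 :=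
    fun w hw => by simpa using hw
  refine ⟨⟨f, hcont⟩, hexp, hf0, ?_, ?_⟩
  · intro w hw w' hw' h
    have hww : w ^ 2 = w' ^ 2 := D.chart.injOn (D.closedBall_subset (hsq w hw))
      (D.closedBall_subset (hsq w' hw')) (by rw [← hproj w hw, ← hproj w' hw']; exact congrArg _ h)
    rcases sq_eq_sq_iff_eq_or_eq_neg.1 hww with e | e
    · exact e
    · by_cases hw0 : w' = 0
      · rw [e, hw0, neg_zero]
      -- Passing from `w'` to `-w'` adds `2πi` to `2 * log w'`, which exchanges the sheets, so `f`
      -- cannot agree at the two points.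
      exfalso
      have h1 : Complex.exp ((2 * Complex.log w') / 2) = w' := by
        rw [mul_div_cancel_left₀ _ two_ne_zero, Complex.exp_log hw0]
      have h2 : Complex.exp ((2 * Complex.log w' + 2 * Real.pi * Complex.I) / 2) = -w' := by
        rw [add_div, Complex.exp_add, h1, mul_assoc, mul_div_cancel_left₀ _ two_ne_zero,
          Complex.exp_pi_mul_I, mul_neg_one]
      have h3 : f (-w') = f w' := by rw [← e]; exact h
      rw [← h2, hexp, lift_add_two_pi hs, ← h1, hexp, h1] at h3
      exact swapRegular_ne _ (Subtype.ext h3)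
  · ext a
    constructor
    · rintro ⟨w, hw, rfl⟩
      exact ⟨w ^ 2, hsq w hw, (hproj w hw).symm⟩
    · intro ha
      by_cases hP : c.proj a = D.center
      · exact ⟨0, by simp, by rw [c.eq_cone_of_proj_eq hP]; exact hf0⟩
      obtain ⟨z, hz, hza⟩ := D.exists_polar_eq ha hP
      have hball : ∀ z : ℂ, z.re ≤ 0 → Complex.exp (z / 2) ∈ Metric.closedBall (0 : ℂ) 1 :=
        fun z hz => by simp [Complex.norm_exp]; linarith
      rcases c.eq_or_eq_swap_of_proj_eq (a := (s z).1) (b := a)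
        ((hpolar z).trans hza) with e | e
      · exact ⟨_, hball z hz, by rw [e]; exact hexp z⟩
      · refine ⟨_, hball (z + 2 * Real.pi * Complex.I) (by simpa using hz), ?_⟩
        refine (hexp _).trans ?_
        rw [lift_add_two_pi hs, e]
        rfl

end Lift

end Cut

end PuncturedSurface

namespace PuncturedSurface

/-! ### Loops around a puncture in the orbifold groupoid -/

section OrbifoldClass

variable {X : Type*} [TopologicalSpace X] {Pu : Set X}

/-- The class of a path in the orbifold fundamental groupoid. -/
noncomputable def orbClass {x y : (Puᶜ : Set X)} (γ : Path x y) :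
    (OrbifoldGroupoid.quotientFunctor Pu).obj ⟨x⟩ ⟶ (OrbifoldGroupoid.quotientFunctor Pu).obj ⟨y⟩ :=
  (OrbifoldGroupoid.quotientFunctor Pu).map
    (FundamentalGroupoid.fromPath (Path.Homotopic.Quotient.mk γ))

theorem orbClass_eq_of_homotopic {x y : (Puᶜ : Set X)} {γ γ' : Path x y} (h : γ.Homotopic γ') :
    orbClass γ = orbClass γ' := by
  rw [orbClass, orbClass, Path.Homotopic.Quotient.eq.2 h]

theorem orbClass_trans {x y z : (Puᶜ : Set X)} (γ : Path x y) (γ' : Path y z) :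
    orbClass (γ.trans γ') = orbClass γ ≫ orbClass γ' :=
  (OrbifoldGroupoid.quotientFunctor Pu).map_comp
    (FundamentalGroupoid.fromPath (Path.Homotopic.Quotient.mk γ))
    (FundamentalGroupoid.fromPath (Path.Homotopic.Quotient.mk γ'))

theorem orbClass_refl (x : (Puᶜ : Set X)) : orbClass (Path.refl x) = 𝟙 _ :=
  (OrbifoldGroupoid.quotientFunctor Pu).map_id ⟨x⟩

theorem orbClass_symm_trans {x y : (Puᶜ : Set X)} (γ : Path x y) :
    orbClass γ.symm ≫ orbClass γ = 𝟙 _ := by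
  rw [← orbClass_trans, ← orbClass_refl]
  exact orbClass_eq_of_homotopic (Path.Homotopic.symm_trans γ)

namespace PunctureDisc

variable (D : PunctureDisc Pu)

/-- The relation `e = e⁻¹` gives `e² = 1`. Agreement with the loop is pointwise in `X`, so that base
points given by another expression are allowed. -/
theorem orbClass_sq_of_eq_loop {x : (Puᶜ : Set X)} (γ : Path x x)
    (hγ : ∀ t, (γ t : X) = D.loop t) : orbClass γ ≫ orbClass γ = 𝟙 _ := by
  obtain rfl : x = ⟨_, D.chart_circle_mem 0⟩ := by
    rw [← γ.source, ← D.loop.source]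
    exact Subtype.ext (hγ 0)
  obtain rfl : γ = D.loop := Path.ext (funext fun t => Subtype.ext (hγ t))
  have h : orbClass D.loop = orbClass D.loop.symm := CategoryTheory.Quotient.sound _ (.turn D)
  nth_rewrite 1 [h]
  exact orbClass_symm_trans _

/-- The disc of radius `|exp b|` inside a disc, turned by the argument of `exp b`. -/
noncomputable def rescale (b : ℂ) (hb : b.re ≤ 0) : PunctureDisc Pu :=
  have hmem : ∀ z ∈ Metric.closedBall (0 : ℂ) 1, Complex.exp b * z ∈ Metric.closedBall (0 : ℂ) 1 :=
    fun z hz => by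
      rw [mem_closedBall_zero_iff] at hz ⊢
      rw [norm_mul, Complex.norm_exp]
      exact mul_le_one₀ (Real.exp_le_one_iff.2 hb) (norm_nonneg z) hz
  { chart := (Homeomorph.mulLeft₀ (Complex.exp b)
      (Complex.exp_ne_zero b)).toOpenPartialHomeomorph.trans D.chart
    closedBall_subset := fun z hz => by
      rw [OpenPartialHomeomorph.trans_source]
      exact ⟨Set.mem_univ _, D.closedBall_subset (hmem z hz)⟩
    center_mem := by simpa using D.center_mem
    eq_center := fun z hz h => by
      have := D.eq_center _ (hmem z hz) (by simpa using h)
      simpa using this }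

theorem rescale_loop (b : ℂ) (hb : b.re ≤ 0) (t : I) :
    ((D.rescale b hb).loop t : X) = D.polar (b + 2 * Real.pi * Complex.I * (t : ℝ)) := by
  rw [polar_coe, clampExp_of_re_le (by simpa using hb), Complex.exp_add]
  change D.chart (Complex.exp b * Complex.exp (((2 * Real.pi * t : ℝ) : ℂ) * Complex.I)) = _
  congr 3
  push_cast
  ring

/-- The loop that runs `k` times around the puncture. -/
noncomputable def loopAt (b : ℂ) (k : ℤ) : Path (D.polar b) (D.polar b) where
  toFun t := D.polar (b + k * (2 * Real.pi * Complex.I) * (t : ℝ))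
  continuous_toFun := by fun_prop
  source' := by simp
  target' := by simpa using D.polar_add_two_pi_mul b k

theorem loopAt_apply (b : ℂ) (k : ℤ) (t : I) :
    D.loopAt b k t = D.polar (b + k * (2 * Real.pi * Complex.I) * (t : ℝ)) := rfl

theorem loopAt_zero (b : ℂ) : D.loopAt b 0 = Path.refl _ := by
  ext t
  simp [loopAt_apply]

/-- The straight path between two complex numbers. -/
noncomputable def _root_.PuncturedSurface.straight (a v : ℂ) : Path a (a + v) where
  toFun t := a + v * (t : ℝ)
  continuous_toFun := by fun_prop
  source' := by simp
  target' := by simp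

/-- Both sides are images of paths in the simply connected plane with the same ends; periodicity of
polar coordinates accounts for the shifted start of the second factor. -/
theorem orbClass_loopAt_add (b : ℂ) (k l : ℤ) :
    orbClass (D.loopAt b (k + l)) = orbClass (D.loopAt b k) ≫ orbClass (D.loopAt b l) := by
  rw [← orbClass_trans]
  apply orbClass_eq_of_homotopic
  set v : ℂ := 2 * Real.pi * Complex.I with hv
  have hend : b + ((k + l : ℤ) : ℂ) * v = b + k * v + l * v := by push_cast; ring
  have h := (SimplyConnectedSpace.paths_homotopic (straight b ((k + l : ℤ) * v))
    (((straight b (k * v)).trans (straight (b + k * v) (l * v))).cast rfl hend)).map D.polar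
  have hb : D.polar b = D.polar (b + ((k + l : ℤ) : ℂ) * v) :=
    (D.polar_add_two_pi_mul b (k + l)).symm
  have h' := h.pathCast (rfl : D.polar b = D.polar b) hb
  convert h' using 1
  · ext t
    rfl
  · ext t
    simp only [Path.cast_coe, Path.map_coe, Function.comp_apply, Path.trans_apply, loopAt_apply]
    split_ifs with ht
    · rfl
    · change (D.polar _ : X) = D.polar (b + k * v + l * v * _)
      rw [add_right_comm, D.polar_add_two_pi_mul]

/-- The defining relation holds for every disc, in particular for the one rescaled by `exp b`, whose
boundary loop starts at `D.polar b`. -/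
theorem orbClass_loopAt_two {b : ℂ} (hb : b.re ≤ 0) : orbClass (D.loopAt b 2) = 𝟙 _ := by
  rw [show (2 : ℤ) = 1 + 1 by norm_num, orbClass_loopAt_add]
  refine (D.rescale b hb).orbClass_sq_of_eq_loop _ fun t => ?_
  rw [rescale_loop, loopAt_apply]
  simp

theorem orbClass_loopAt_two_mul {b : ℂ} (hb : b.re ≤ 0) (k : ℤ) :
    orbClass (D.loopAt b (k * 2)) = 𝟙 _ := by
  induction k with
  | zero => rw [zero_mul, loopAt_zero, orbClass_refl]
  | succ k ih =>
    rw [add_mul, one_mul, orbClass_loopAt_add, ih, orbClass_loopAt_two D hb, Category.comp_id]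
  | pred k ih =>
    rw [← ih, show (-(k : ℤ)) * 2 = (-(k : ℤ) - 1) * 2 + 2 by ring, orbClass_loopAt_add,
      orbClass_loopAt_two D hb, Category.comp_id]

/-- Two paths in a punctured disc with the same class modulo twice the loop around the puncture have
the same class in the orbifold groupoid. -/
theorem orbClass_eq_of_polar {x y : (Puᶜ : Set X)} {γ γ' : Path x y} {ζ ζ' : C(I, ℂ)}
    (hγ : ∀ t, γ t = D.polar (ζ t)) (hγ' : ∀ t, γ' t = D.polar (ζ' t)) (h0 : ζ' 0 = ζ 0) {k : ℤ}
    (h1 : ζ' 1 = ζ 1 + (k * 2 : ℤ) * (2 * Real.pi * Complex.I)) (hre : (ζ 1).re ≤ 0) :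
    orbClass γ = orbClass γ' := by
  obtain rfl : x = D.polar (ζ 0) := by rw [← hγ, γ.source]
  obtain rfl : y = D.polar (ζ 1) := by rw [← hγ, γ.target]
  -- Appending an even number of turns, trivial in the orbifold groupoid, makes the two paths of
  -- logarithms end at the same point of the plane.
  rw [← Category.comp_id (orbClass γ), ← D.orbClass_loopAt_two_mul hre k, ← orbClass_trans]
  apply orbClass_eq_of_homotopic
  set v : ℂ := 2 * Real.pi * Complex.I with hv
  let q : Path (ζ 0) (ζ 1) := ⟨ζ, rfl, rfl⟩
  let q' : Path (ζ 0) (ζ 1 + (k * 2 : ℤ) * v) := ⟨ζ', h0, h1⟩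
  have h := (SimplyConnectedSpace.paths_homotopic
    (q.trans (straight (ζ 1) ((k * 2 : ℤ) * v))) q').map D.polar
  have hb : D.polar (ζ 1) = D.polar (ζ 1 + ((k * 2 : ℤ) : ℂ) * v) :=
    (D.polar_add_two_pi_mul (ζ 1) (k * 2)).symm
  have h' := h.pathCast (rfl : D.polar (ζ 0) = D.polar (ζ 0)) hb
  convert h' using 1
  · ext t
    simp only [Path.cast_coe, Path.map_coe, Function.comp_apply, Path.trans_apply]
    split_ifs with ht
    · rw [hγ]; rfl
    · rfl
  · ext t
    rw [hγ']; rfl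

end PunctureDisc

end OrbifoldClass

/-! ### Paths in the cover over a disc -/

namespace Cut

variable {X : Type*} [TopologicalSpace X] [ChartedSpace (EuclideanHalfSpace 2) X]
  {Pu : Set X} {A : ArcSystem Pu} {Y : Type*} [TopologicalSpace Y]
  [ChartedSpace (EuclideanHalfSpace 2) Y] {c : Cut A Y}
  [T2Space X] [T2Space Y] [CompactSpace Y] [Finite Pu] (D : PunctureDisc Pu)

variable (c) in
/-- The inclusion of the regular part into the cover. -/
def regularIncl : C(c.regular, c.Cover) := ⟨Subtype.val, continuous_subtype_val⟩

/-- On the closed unit disc `f` is a continuous injection from a compact space into a Hausdorff one,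
hence an embedding, and paths over the disc can be read in the coordinate `w`. -/
theorem exists_lift_plane {f : C(ℂ, c.Cover)} (hinj : Set.InjOn f (Metric.closedBall 0 1))
    (himg : f '' Metric.closedBall 0 1 = c.proj ⁻¹' D.disc) (g : C(I, c.Cover))
    (hg : ∀ t, c.proj (g t) ∈ D.disc) :
    ∃ w : C(I, ℂ), (∀ t, w t ∈ Metric.closedBall (0 : ℂ) 1) ∧ ∀ t, f (w t) = g t := by
  let F : Metric.closedBall (0 : ℂ) 1 → c.Cover := fun w => f w
  have hF : Continuous F := f.continuous.comp continuous_subtype_val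
  have : CompactSpace (Metric.closedBall (0 : ℂ) 1) :=
    isCompact_iff_compactSpace.1 (isCompact_closedBall _ _)
  have hemb : IsEmbedding F := (hF.isClosedEmbedding fun w w' h =>
    Subtype.ext (hinj w.2 w'.2 h)).isEmbedding
  have hmem : ∀ t, g t ∈ Set.range F := fun t => by
    have : g t ∈ f '' Metric.closedBall 0 1 := himg ▸ hg t
    obtain ⟨w, hw, h⟩ := this
    exact ⟨⟨w, hw⟩, h⟩
  let e := hemb.toHomeomorph
  refine ⟨⟨fun t => (e.symm ⟨g t, hmem t⟩).1, by fun_prop⟩, fun t => (e.symm ⟨g t, hmem t⟩).2,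
    fun t => ?_⟩
  exact congrArg Subtype.val (e.apply_symm_apply ⟨g t, hmem t⟩)

theorem exists_lift_of_disc : ∃ s : C(ℂ, c.regular), ∀ z, c.projRegular (s z) = D.polar z := by
  obtain ⟨a, ha⟩ := c.proj_surjective (D.polar 0)
  have har : a ∈ c.regular := by
    change c.proj a ∈ Puᶜ
    rw [ha]; exact (D.polar 0).2
  obtain ⟨s, -, hs⟩ := exists_lift_polar (c := c) (D := D) (a := ⟨a, har⟩) (z₀ := 0)
    (Subtype.ext ha)
  exact ⟨s, hs⟩

theorem norm_exp_half_le {z : ℂ} (hz : z.re ≤ 0) :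
    Complex.exp (z / 2) ∈ Metric.closedBall (0 : ℂ) 1 := by
  simp [Complex.norm_exp]
  linarith

variable {D} {s : C(ℂ, c.regular)} (hs : ∀ z, c.projRegular (s z) = D.polar z)
include hs

omit [T2Space X] [T2Space Y] [CompactSpace Y] [Finite Pu] in
theorem lift_mem_disc (z : ℂ) : c.proj (s z) ∈ D.disc := by
  have : c.proj (s z) = D.polar z := congrArg Subtype.val (hs z)
  rw [this]
  exact D.polar_mem z

/-- A regular path avoids the origin of the `w`-disc, so its coordinate has a continuous logarithm;
doubling it undoes the halving in `f (exp (z / 2)) = s z`. -/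
theorem exists_lift_log {a b : c.regular} (δ : Path a b) (hδ : ∀ t, c.proj (δ t) ∈ D.disc) :
    ∃ ζ : C(I, ℂ), (∀ t, (ζ t).re ≤ 0) ∧ ∀ t, s (ζ t) = δ t := by
  obtain ⟨f, hf, hf0, hinj, himg⟩ := exists_branched_disc hs
  obtain ⟨w, hw, hfw⟩ := exists_lift_plane D hinj himg
    ((c.regularIncl).comp δ.toContinuousMap) hδ
  have hw0 : ∀ t, w t ≠ 0 := fun t h => by
    have h1 := hfw t
    rw [h, hf0] at h1
    refine (δ t).2 ?_
    change c.proj (δ t) ∈ Pu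
    have : (δ t : c.Cover) = c.cone D.center := h1.symm
    rw [this, proj_cone]
    exact D.center.2
  obtain ⟨Γ, hΓ, -⟩ := Complex.isCoveringMap_exp.exists_path_lifts
    ⟨fun t => (⟨w t, hw0 t⟩ : {z : ℂ // z ≠ 0}), by fun_prop⟩ (Complex.log (w 0))
    (Subtype.ext (Complex.exp_log (hw0 0)).symm)
  have hΓ' : ∀ t, Complex.exp (Γ t) = w t := fun t => congrArg Subtype.val (congrFun hΓ t)
  refine ⟨⟨fun t => 2 * Γ t, by fun_prop⟩, fun t => ?_, fun t => Subtype.ext ?_⟩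
  · have h1 : ‖w t‖ ≤ 1 := by simpa using hw t
    rw [← hΓ', Complex.norm_exp, Real.exp_le_one_iff] at h1
    have h2 : (Γ t).re ≤ 0 := by simpa using h1
    have h3 : (2 * Γ t).re = 2 * (Γ t).re := by simp
    exact h3.trans_le (by linarith)
  · have h1 := hf (2 * Γ t)
    rw [mul_div_cancel_left₀ _ two_ne_zero, hΓ', hfw] at h1
    exact h1.symm

theorem exists_lift_eq {a : c.regular} (ha : c.proj a ∈ D.disc) :
    ∃ z : ℂ, z.re ≤ 0 ∧ s z = a := by
  obtain ⟨ζ, h, h'⟩ := exists_lift_log hs (Path.refl a) fun _ => ha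
  exact ⟨ζ 0, h 0, h' 0⟩

theorem exists_int_of_lift_eq {z z' : ℂ} (hz : z.re ≤ 0) (hz' : z'.re ≤ 0) (h : s z' = s z) :
    ∃ k : ℤ, z' = z + (k * 2 : ℤ) * (2 * Real.pi * Complex.I) := by
  obtain ⟨f, hf, -, hinj, -⟩ := exists_branched_disc hs
  have := hinj (norm_exp_half_le hz') (norm_exp_half_le hz) (by rw [hf, hf, h])
  obtain ⟨k, hk⟩ := Complex.exp_eq_exp_iff_exists_int.1 this
  refine ⟨k, ?_⟩
  push_cast
  linear_combination 2 * hk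

omit hs in
variable (D) in
/-- Two regular paths over a disc with the same endpoints have the same image in the orbifold
groupoid. -/
theorem orbClass_map_eq_of_disc {a b : c.regular} (δ δ' : Path a b)
    (hδ : ∀ t, c.proj (δ t) ∈ D.disc) (hδ' : ∀ t, c.proj (δ' t) ∈ D.disc) :
    orbClass (δ.map c.projRegular.continuous) = orbClass (δ'.map c.projRegular.continuous) := by
  obtain ⟨s, hs⟩ := exists_lift_of_disc (c := c) D
  obtain ⟨ζ, hζ, hsζ⟩ := exists_lift_log hs δ hδ
  obtain ⟨ζ', hζ', hsζ'⟩ := exists_lift_log hs δ' hδ'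
  obtain ⟨k, hk⟩ := exists_int_of_lift_eq hs (hζ 0) (hζ' 0) (by
    rw [hsζ, hsζ', δ.source, δ'.source])
  obtain ⟨l, hl⟩ := exists_int_of_lift_eq hs (hζ 1) (hζ' 1) (by
    rw [hsζ, hsζ', δ.target, δ'.target])
  -- Translating `ζ'` by `-k` double turns makes it start where `ζ` does; its end then differs from
  -- that of `ζ` by `l - k` double turns.
  refine D.orbClass_eq_of_polar (ζ := ζ) (k := l - k)
    (ζ' := ⟨fun t => ζ' t + (-(k * 2) : ℤ) * (2 * Real.pi * Complex.I), by fun_prop⟩)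
    (fun t => ?_) (fun t => ?_) ?_ ?_ (hζ 1)
  · rw [← hs, hsζ]; rfl
  · refine Eq.trans ?_ (D.polar_add_two_pi_mul _ _).symm
    rw [← hs, hsζ']; rfl
  · rw [ContinuousMap.coe_mk, hk]; push_cast; ring
  · rw [ContinuousMap.coe_mk, hl]; push_cast; ring

omit hs in
variable (D) in
theorem exists_regular_path_of_disc {a b : c.regular} (ha : c.proj a ∈ D.disc)
    (hb : c.proj b ∈ D.disc) : ∃ δ : Path a b, ∀ t, c.proj (δ t) ∈ D.disc := by
  obtain ⟨s, hs⟩ := exists_lift_of_disc (c := c) D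
  obtain ⟨z, -, rfl⟩ := exists_lift_eq hs ha
  obtain ⟨z', -, rfl⟩ := exists_lift_eq hs hb
  exact ⟨(PathConnectedSpace.somePath z z').map s.continuous, fun t => lift_mem_disc hs _⟩

omit hs in
variable (D) in
/-- A path over a disc with regular endpoints is homotopic to a regular path over the disc. -/
theorem exists_regular_path_homotopic {a b : c.regular} (α : Path a.1 b.1)
    (hα : ∀ t, c.proj (α t) ∈ D.disc) :
    ∃ δ : Path a b, (δ.map c.regularIncl.continuous).Homotopic α := by
  obtain ⟨s, hs⟩ := exists_lift_of_disc (c := c) D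
  obtain ⟨f, hf, -, hinj, himg⟩ := exists_branched_disc hs
  obtain ⟨w, hw, hfw⟩ := exists_lift_plane D hinj himg α.toContinuousMap hα
  obtain ⟨z, hz, rfl⟩ := exists_lift_eq hs (a := a) (by simpa using hα 0)
  obtain ⟨z', hz', rfl⟩ := exists_lift_eq hs (a := b) (by simpa using hα 1)
  have hw0 : w 0 = Complex.exp (z / 2) := hinj (hw 0) (norm_exp_half_le hz)
    (by rw [hfw, hf]; exact α.source)
  have hw1 : w 1 = Complex.exp (z' / 2) := hinj (hw 1) (norm_exp_half_le hz')
    (by rw [hfw, hf]; exact α.target)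
  -- Any path of logarithms will do: in `Σ̃` the origin of the `w`-plane need not be avoided, and
  -- the plane is simply connected.
  let q := PathConnectedSpace.somePath z z'
  refine ⟨q.map s.continuous, ?_⟩
  have h := ((SimplyConnectedSpace.paths_homotopic
    (q.map (f := fun z => Complex.exp (z / 2)) (by fun_prop))
    ⟨w, hw0, hw1⟩).map f).pathCast (hf z).symm (hf z').symm
  have e1 : (q.map s.continuous).map c.regularIncl.continuous =
      ((q.map (f := fun z => Complex.exp (z / 2)) (by fun_prop)).map f.continuous).cast
        (hf z).symm (hf z').symm := Path.ext (funext fun t => (hf (q t)).symm)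
  have e2 : ((⟨w, hw0, hw1⟩ : Path _ _).map f.continuous).cast (hf z).symm (hf z').symm = α :=
    Path.ext (funext hfw)
  rw [e1]
  rw [e2] at h
  exact h

omit hs in
variable (c D) in
theorem exists_path_to_cone :
    ∃ (a : c.regular) (r : Path a.1 (c.cone D.center)), ∀ t, c.proj (r t) ∈ D.disc := by
  obtain ⟨s, hs⟩ := exists_lift_of_disc (c := c) D
  obtain ⟨f, hf, hf0, -, himg⟩ := exists_branched_disc hs
  refine ⟨s 0, ⟨⟨fun t => f (1 - (t : ℝ)), by fun_prop⟩, ?_, ?_⟩, fun t => ?_⟩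
  · simpa using hf 0
  · simpa using hf0
  · change f (1 - (t : ℝ)) ∈ c.proj ⁻¹' D.disc
    rw [← himg]
    refine ⟨_, ?_, rfl⟩
    rw [mem_closedBall_zero_iff, ← Complex.ofReal_one, ← Complex.ofReal_sub, Complex.norm_real,
      Real.norm_eq_abs, abs_le]
    constructor <;> linarith [t.2.1, t.2.2]

omit hs in
variable (D) in
/-- The two lifts of the loop around a disc and of its inverse are homotopic in the cover. -/
theorem exists_lifts_loop {a : c.regular} (ha : (c.projRegular a : X) = D.loop 0) :
    ∃ (b : c.regular) (γ γ' : Path a b), (∀ t, c.projRegular (γ t) = D.loop t) ∧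
      (∀ t, c.projRegular (γ' t) = D.loop (σ t)) ∧
      (γ.map c.regularIncl.continuous).Homotopic (γ'.map c.regularIncl.continuous) := by
  have hloop : ∀ t : ℝ, ∀ h, (⟨D.chart (Complex.exp (t * Complex.I)), h⟩ : (Puᶜ : Set X))
      = D.polar (t * Complex.I) := fun t h => Subtype.ext (by
    rw [D.polar_coe, clampExp_of_re_le (by simp)])
  have hloop' : ∀ t : I, D.loop t = D.polar ((2 * Real.pi * t : ℝ) * Complex.I) :=
    fun t => hloop (2 * Real.pi * t) (D.chart_circle_mem _)
  obtain ⟨s, hs0, hs⟩ := exists_lift_polar (c := c) (D := D) (a := a) (z₀ := 0)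
    (Subtype.ext (by rw [ha, hloop']; simp))
  subst hs0
  obtain ⟨f, hf, -, -, -⟩ := exists_branched_disc hs
  -- The two lifts end together because their final logarithms `2πi` and `-2πi` differ by the period
  -- `4πi`.
  have hend : s ((-(2 * Real.pi * 1) : ℝ) * Complex.I)
      = s ((2 * Real.pi * 1 : ℝ) * Complex.I) := by
    rw [← lift_periodic hs]
    congr 1
    push_cast
    ring
  refine ⟨s ((2 * Real.pi * 1 : ℝ) * Complex.I),
    ⟨⟨fun t => s ((2 * Real.pi * t : ℝ) * Complex.I), by fun_prop⟩, by simp, by simp⟩,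
    ⟨⟨fun t => s ((-(2 * Real.pi * t) : ℝ) * Complex.I), by fun_prop⟩, by simp, hend⟩,
    fun t => ?_, fun t => ?_, ?_⟩
  · rw [hloop', ← hs]; rfl
  · rw [hloop']
    change c.projRegular (s _) = _
    rw [hs, ← D.polar_add_two_pi_mul _ 1]
    congr 1
    simp
    ring
  · have h1 : Complex.exp (((2 * Real.pi * 1 : ℝ) * Complex.I) / 2) = -1 := by
      rw [← Complex.exp_pi_mul_I]
      congr 1
      push_cast
      ring
    have h2 : Complex.exp (((-(2 * Real.pi * 1) : ℝ) * Complex.I) / 2) = -1 := by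
      rw [show (((-(2 * Real.pi * 1) : ℝ) : ℂ) * Complex.I) / 2 = -(Real.pi * Complex.I) by
        push_cast; ring, Complex.exp_neg, Complex.exp_pi_mul_I]
      norm_num
    -- In the coordinate `w` the two lifts are the upper and the lower unit semicircle from `1` to
    -- `-1`.
    let q : Path (1 : ℂ) (-1) := ⟨⟨fun t => Complex.exp (((2 * Real.pi * t : ℝ) * Complex.I) / 2),
      by fun_prop⟩, by simp, h1⟩
    let q' : Path (1 : ℂ) (-1) :=
      ⟨⟨fun t => Complex.exp (((-(2 * Real.pi * t) : ℝ) * Complex.I) / 2), by fun_prop⟩,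
        by simp, h2⟩
    have h := ((SimplyConnectedSpace.paths_homotopic q q').map f).pathCast
      (show (c.regularIncl (s 0)) = f 1 by
        have := hf 0
        rw [zero_div, Complex.exp_zero] at this
        exact this.symm)
      (show (c.regularIncl (s ((2 * Real.pi * 1 : ℝ) * Complex.I))) = f (-1) by
        rw [← h1, hf]; rfl)
    convert h using 1
    · ext t
      exact (hf _).symm
    · ext t
      exact (hf _).symm

end Cut

end PuncturedSurface

namespace PuncturedSurface

namespace Cut

/-! ### Lifting relations of the orbifold groupoid to the cover -/

section LiftRel

variable {X : Type*} [TopologicalSpace X] [ChartedSpace (EuclideanHalfSpace 2) X]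
  {Pu : Set X} {A : ArcSystem Pu} {Y : Type*} [TopologicalSpace Y]
  [ChartedSpace (EuclideanHalfSpace 2) Y] (c : Cut A Y)

/-- Every lift of the class `f` is homotopic in the cover to some lift of the class `g`. -/
def LiftRel {x y : (Puᶜ : Set X)} (f g : Path.Homotopic.Quotient x y) : Prop :=
  ∀ (a b : c.regular) (ha : c.projRegular a = x) (hb : c.projRegular b = y)
    (α : Path.Homotopic.Quotient a b), α.map c.projRegular = f.cast ha hb →
    ∃ β : Path.Homotopic.Quotient a b, β.map c.projRegular = g.cast ha hb ∧
      α.map c.regularIncl = β.map c.regularIncl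

variable {c}

theorem LiftRel.refl {x y : (Puᶜ : Set X)} (f : Path.Homotopic.Quotient x y) : c.LiftRel f f :=
  fun _ _ _ _ α hα => ⟨α, hα, rfl⟩

theorem LiftRel.trans {x y : (Puᶜ : Set X)} {f g h : Path.Homotopic.Quotient x y}
    (h₁ : c.LiftRel f g) (h₂ : c.LiftRel g h) : c.LiftRel f h := fun a b ha hb α hα => by
  obtain ⟨β, hβ, hαβ⟩ := h₁ a b ha hb α hα
  obtain ⟨γ, hγ, hβγ⟩ := h₂ a b ha hb β hβ
  exact ⟨γ, hγ, hαβ.trans hβγ⟩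

theorem map_quotient_trans {S T : Type*} [TopologicalSpace S] [TopologicalSpace T] {x y z : S}
    (p : Path.Homotopic.Quotient x y) (q : Path.Homotopic.Quotient y z) (f : C(S, T)) :
    (p.trans q).map f = (p.map f).trans (q.map f) :=
  (FundamentalGroupoid.map f).map_comp (X := ⟨x⟩) (Y := ⟨y⟩) (Z := ⟨z⟩) p q

theorem map_quotient_symm {S T : Type*} [TopologicalSpace S] [TopologicalSpace T] {x y : S}
    (p : Path.Homotopic.Quotient x y) (f : C(S, T)) : p.symm.map f = (p.map f).symm := by
  induction p using Path.Homotopic.Quotient.ind with | mk p => rfl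

variable [T2Space X] [T2Space Y] [CompactSpace Y] [Finite Pu]

/-- A lift of a composition is a composition of lifts. -/
theorem exists_lift_trans {a b : c.regular} {y : (Puᶜ : Set X)}
    {f : Path.Homotopic.Quotient (c.projRegular a) y}
    {g : Path.Homotopic.Quotient y (c.projRegular b)} {α : Path.Homotopic.Quotient a b}
    (h : α.map c.projRegular = f.trans g) :
    ∃ (d : c.regular) (hd : c.projRegular d = y) (α₁ : Path.Homotopic.Quotient a d)
      (α₂ : Path.Homotopic.Quotient d b), α₁.map c.projRegular = f.cast rfl hd ∧
        α₂.map c.projRegular = g.cast hd rfl ∧ α = α₁.trans α₂ := by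
  have h₁ := c.isCoveringMap_projRegular.map_liftPathQuotient f ⟨a, rfl⟩
  generalize c.isCoveringMap_projRegular.liftPathQuotient f ⟨a, rfl⟩ = α₁ at h₁
  generalize c.isCoveringMap_projRegular.monodromy f ⟨a, rfl⟩ = d at α₁ h₁
  obtain ⟨d, rfl⟩ := d
  have h₁ : α₁.map c.projRegular = f := h₁.trans (by simp)
  refine ⟨d, rfl, α₁, α₁.symm.trans α, by simpa using h₁, ?_, ?_⟩
  · rw [map_quotient_trans, map_quotient_symm, h, h₁, ← Path.Homotopic.Quotient.trans_assoc]
    simp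
  · rw [← Path.Homotopic.Quotient.trans_assoc]
    simp

theorem LiftRel.comp_left {x y z : (Puᶜ : Set X)} (f : Path.Homotopic.Quotient x y)
    {g g' : Path.Homotopic.Quotient y z} (h : c.LiftRel g g') :
    c.LiftRel (f.trans g) (f.trans g') := by
  rintro a b rfl rfl α hα
  obtain ⟨d, rfl, α₁, α₂, h₁, h₂, rfl⟩ := exists_lift_trans (by simpa using hα)
  obtain ⟨β, hβ, hαβ⟩ := h _ _ rfl rfl α₂ h₂
  refine ⟨α₁.trans β, ?_, ?_⟩
  · rw [map_quotient_trans, h₁, hβ]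
    simp
  · rw [map_quotient_trans, map_quotient_trans, hαβ]

theorem LiftRel.comp_right {x y z : (Puᶜ : Set X)} {f f' : Path.Homotopic.Quotient x y}
    (g : Path.Homotopic.Quotient y z) (h : c.LiftRel f f') :
    c.LiftRel (f.trans g) (f'.trans g) := by
  rintro a b rfl rfl α hα
  obtain ⟨d, rfl, α₁, α₂, h₁, h₂, rfl⟩ := exists_lift_trans (by simpa using hα)
  obtain ⟨β, hβ, hαβ⟩ := h _ _ rfl rfl α₁ h₁
  refine ⟨β.trans α₂, ?_, ?_⟩
  · rw [map_quotient_trans, h₂, hβ]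
    simp
  · rw [map_quotient_trans, map_quotient_trans, hαβ]

omit [T2Space X] [T2Space Y] [CompactSpace Y] [Finite Pu] in
-- A lift of a class is determined, together with its endpoint, by its starting point, so one pair
-- of lifts from each starting point suffices.
theorem liftRel_of_paths {x y : (Puᶜ : Set X)} {f g : Path x y} (hcov : IsCoveringMap c.projRegular)
    (h : ∀ a : c.regular, c.projRegular a = x → ∃ (b : c.regular) (γ γ' : Path a b),
      (∀ t, c.projRegular (γ t) = f t) ∧ (∀ t, c.projRegular (γ' t) = g t) ∧
      (γ.map c.regularIncl.continuous).Homotopic (γ'.map c.regularIncl.continuous)) :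
    c.LiftRel (.mk f) (.mk g) := by
  rintro a b ha hb α hα
  obtain ⟨b', γ, γ', hγ, hγ', hh⟩ := h a ha
  have hb' : c.projRegular b' = y := by rw [← γ.target, hγ, f.target]
  have e : ∀ {d : c.regular} (hd : c.projRegular d = y) (δ : Path a d) (k : Path x y),
      (∀ t, c.projRegular (δ t) = k t) →
      (Path.Homotopic.Quotient.mk δ).map c.projRegular =
        (Path.Homotopic.Quotient.mk k).cast ha hd := fun hd δ k hk => by
    rw [← Path.Homotopic.Quotient.mk_map, ← Path.Homotopic.Quotient.mk_cast]
    congr 1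
    exact Path.ext (funext hk)
  have m1 := hcov.monodromy_eq_of_map_eq (γ := Path.Homotopic.Quotient.mk f)
    (ex := ⟨a, ha⟩) (ey := ⟨b, hb⟩) α hα
  have m2 := hcov.monodromy_eq_of_map_eq (γ := Path.Homotopic.Quotient.mk f)
    (ex := ⟨a, ha⟩) (ey := ⟨b', hb'⟩) (.mk γ) (e hb' γ f hγ)
  obtain rfl : b = b' := congrArg Subtype.val (m1.symm.trans m2)
  obtain rfl : α = .mk γ := hcov.injective_path_homotopic_map a b (hα.trans (e hb γ f hγ).symm)
  refine ⟨.mk γ', e hb γ' g hγ', ?_⟩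
  rw [← Path.Homotopic.Quotient.mk_map, ← Path.Homotopic.Quotient.mk_map]
  exact Path.Homotopic.Quotient.eq.2 hh

theorem liftRel_loop (D : PunctureDisc Pu) :
    c.LiftRel (.mk D.loop) (.mk D.loop.symm) ∧ c.LiftRel (.mk D.loop.symm) (.mk D.loop) := by
  have key : ∀ a : c.regular, c.projRegular a = ⟨_, D.chart_circle_mem 0⟩ → _ := fun a ha =>
    exists_lifts_loop D (a := a) (by rw [ha, D.loop.source])
  constructor <;> refine liftRel_of_paths c.isCoveringMap_projRegular fun a ha => ?_
  · obtain ⟨b, γ, γ', h, h', hh⟩ := key a ha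
    exact ⟨b, γ, γ', h, h', hh⟩
  · obtain ⟨b, γ, γ', h, h', hh⟩ := key a ha
    exact ⟨b, γ', γ, h', h, hh.symm⟩

/-- Equality in the quotient is the equivalence generated by elementary relations placed between two
morphisms, and `LiftRel` is stable under these operations. It is not visibly symmetric, so both
directions are carried through the induction. -/
theorem liftRel_of_quotientFunctor_map_eq {x y : FundamentalGroupoid (Puᶜ : Set X)} {f g : x ⟶ y}
    (h : (OrbifoldGroupoid.quotientFunctor Pu).map f =
      (OrbifoldGroupoid.quotientFunctor Pu).map g) : c.LiftRel f g := by
  have h' := (CategoryTheory.Quotient.functor_homRel_eq_compClosure_eqvGen _ f g).1 h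
  suffices c.LiftRel f g ∧ c.LiftRel g f from this.1
  clear h
  induction h' with
  | rel f g h =>
    obtain ⟨u, v, k, m₁, m₂, l, h⟩ := h
    obtain ⟨D⟩ := h
    exact ⟨((liftRel_loop D).1.comp_right l).comp_left k,
      ((liftRel_loop D).2.comp_right l).comp_left k⟩
  | refl f => exact ⟨.refl f, .refl f⟩
  | symm f g _ ih => exact ih.symm
  | trans f g k _ _ ih ih' => exact ⟨ih.1.trans ih'.1, ih'.2.trans ih.2⟩

/-- Classes of regular paths with the same image in the orbifold groupoid agree in the cover. -/
theorem map_regularIncl_eq {a b : c.regular} {α α' : Path.Homotopic.Quotient a b}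
    (h : (OrbifoldGroupoid.quotientFunctor Pu).map
        (FundamentalGroupoid.fromPath (α.map c.projRegular)) =
      (OrbifoldGroupoid.quotientFunctor Pu).map
        (FundamentalGroupoid.fromPath (α'.map c.projRegular))) :
    α.map c.regularIncl = α'.map c.regularIncl := by
  obtain ⟨β, hβ, hαβ⟩ := liftRel_of_quotientFunctor_map_eq h a b rfl rfl α (by simp)
  have : β = α' := c.isCoveringMap_projRegular.injective_path_homotopic_map a b
    (hβ.trans (Path.Homotopic.Quotient.cast_rfl_rfl _))
  rw [hαβ, this]

end LiftRel

end Cut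

end PuncturedSurface

namespace PuncturedSurface

/-! ### Extending a functor from the members of a cover -/

section Grid

variable {C : Type*} [Category* C]

/-- The composite of the first `n` morphisms of a sequence. -/
def chain {X : ℕ → C} (f : ∀ k, X k ⟶ X (k + 1)) : ∀ n, X 0 ⟶ X n
  | 0 => 𝟙 _
  | n + 1 => chain f n ≫ f n

theorem comp_chain {X Y : ℕ → C} {f : ∀ k, X k ⟶ X (k + 1)} {g : ∀ k, Y k ⟶ Y (k + 1)}
    {v : ∀ k, X k ⟶ Y k} (h : ∀ k, v k ≫ g k = f k ≫ v (k + 1)) (n : ℕ) :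
    v 0 ≫ chain g n = chain f n ≫ v n := by
  induction n with
  | zero => simp [chain]
  | succ n ih => rw [chain, chain, ← Category.assoc, ih, Category.assoc, h, Category.assoc]

/-- The boundary of a grid of commutative squares commutes. -/
theorem chain_comp_chain {X : ℕ → ℕ → C} {f : ∀ k l, X k l ⟶ X (k + 1) l}
    {g : ∀ k l, X k l ⟶ X k (l + 1)}
    (h : ∀ k l, g k l ≫ f k (l + 1) = f k l ≫ g (k + 1) l) (m n : ℕ) :
    chain (g 0) n ≫ chain (f · n) m = chain (f · 0) m ≫ chain (g m) n :=
  (comp_chain (X := X 0) (Y := X m) (v := fun l => chain (f · l) m)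
    (fun l => (comp_chain (v := fun k => g k l) (fun k => h k l) m).symm) n).symm

end Grid

/-- A convex set is contractible, hence simply connected. The homotopy has to stay inside because a
local functor respects only homotopies within one member of the cover. -/
theorem homotopic_codRestrict {E : Type*} [AddCommGroup E] [Module ℝ E] [TopologicalSpace E]
    [ContinuousAdd E] [ContinuousSMul ℝ E] {S : Set E} (hS : Convex ℝ S) {z z' : E}
    (p q : Path z z') (hp : ∀ t, p t ∈ S) (hq : ∀ t, q t ∈ S) :
    ∃ H : Path.Homotopy p q, ∀ t, H t ∈ S := by
  have := hS.contractibleSpace ⟨_, hp 0⟩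
  let lift : ∀ r : Path z z', (∀ t, r t ∈ S) → Path (X := S) ⟨z, by simpa using hp 0⟩
      ⟨z', by simpa using hp 1⟩ := fun r hr =>
    { toFun := fun t => ⟨r t, hr t⟩
      continuous_toFun := by fun_prop
      source' := by simp
      target' := by simp }
  obtain ⟨H⟩ := SimplyConnectedSpace.paths_homotopic (lift p hp) (lift q hq)
  exact ⟨H.map ⟨Subtype.val, continuous_subtype_val⟩, fun t => (H t).2⟩

/-- A functor on the paths that run inside a member of a cover of a space: it assigns a morphism
to each such path, invariant under homotopies inside the member of the cover. -/
structure LocalFunctor {Z ι C : Type*} [TopologicalSpace Z] [Category* C] (U : ι → Set Z)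
    (F : Z → C) where
  map : ∀ (i : ι) {x y : Z} (γ : Path x y), (∀ t, γ t ∈ U i) → (F x ⟶ F y)
  map_indep : ∀ (i j : ι) {x y : Z} (γ : Path x y) (hi : ∀ t, γ t ∈ U i) (hj : ∀ t, γ t ∈ U j),
    map i γ hi = map j γ hj
  map_refl : ∀ (i : ι) (x : Z) (h : ∀ t, Path.refl x t ∈ U i), map i (.refl x) h = 𝟙 _
  map_trans : ∀ (i : ι) {x y z : Z} (γ : Path x y) (γ' : Path y z) (h : ∀ t, γ t ∈ U i)
    (h' : ∀ t, γ' t ∈ U i) (h'' : ∀ t, γ.trans γ' t ∈ U i),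
    map i (γ.trans γ') h'' = map i γ h ≫ map i γ' h'
  map_eq_of_homotopy : ∀ (i : ι) {x y : Z} (γ γ' : Path x y) (h : ∀ t, γ t ∈ U i)
    (h' : ∀ t, γ' t ∈ U i) (H : Path.Homotopy γ γ'), (∀ t, H t ∈ U i) → map i γ h = map i γ' h'

namespace LocalFunctor

theorem trans_mem {Z : Type*} [TopologicalSpace Z] {S : Set Z} {x y z : Z} {γ : Path x y}
    {γ' : Path y z} (h : ∀ t, γ t ∈ S) (h' : ∀ t, γ' t ∈ S) (t : I) : γ.trans γ' t ∈ S := by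
  rw [Path.trans_apply]
  split
  · exact h _
  · exact h' _

variable {Z ι C : Type*} [TopologicalSpace Z] [Category* C] {U : ι → Set Z} {F : Z → C}
  (m : LocalFunctor U F)

theorem map_congr (i : ι) {x y x' y' : Z} (hx : x = x') (hy : y = y') {γ : Path x y}
    {γ' : Path x' y'} (h : ∀ t, γ t ∈ U i) (h' : ∀ t, γ' t ∈ U i) (e : ∀ t, γ t = γ' t) :
    m.map i γ h = eqToHom (congrArg F hx) ≫ m.map i γ' h' ≫ eqToHom (congrArg F hy.symm) := by
  subst hx hy
  obtain rfl : γ = γ' := Path.ext (funext e)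
  simp

theorem _root_.PuncturedSurface.segment_mem {S : Set (ℝ × ℝ)} (hS : Convex ℝ S)
    {z z' : ℝ × ℝ} (hz : z ∈ S) (hz' : z' ∈ S) (t : I) : Path.segment z z' t ∈ S :=
  hS.lineMap_mem hz hz' t.2

variable (K : C(ℝ × ℝ, Z))

/-- The value of a local functor on the image of a segment in the plane. -/
noncomputable def edge (i : ι) (z z' : ℝ × ℝ) (h : ∀ t, K (Path.segment z z' t) ∈ U i) :
    F (K z) ⟶ F (K z') :=
  m.map i ((Path.segment z z').map K.continuous) h

theorem edge_congr {i : ι} {z z' : ℝ × ℝ} (h : ∀ t, K (Path.segment z z' t) ∈ U i) {x y : Z}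
    (hx : K z = x) (hy : K z' = y) {γ : Path x y} (h' : ∀ t, γ t ∈ U i)
    (e : ∀ t, K (Path.segment z z' t) = γ t) :
    m.edge K i z z' h =
      eqToHom (congrArg F hx) ≫ m.map i γ h' ≫ eqToHom (congrArg F hy.symm) :=
  m.map_congr i hx hy h h' e

/-- The two broken lines are homotopic inside the convex set `S`, which `K` maps into `U i`. The
edges carry their own indices because neighbouring boxes of a grid choose members independently. -/
theorem edge_comp_edge {i j k j' k' : ι} {S : Set (ℝ × ℝ)} (hS : Convex ℝ S)
    (hK : ∀ z ∈ S, K z ∈ U i) {a b b' d : ℝ × ℝ} (ha : a ∈ S) (hb : b ∈ S) (hb' : b' ∈ S)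
    (hd : d ∈ S) (h₁ h₂ h₃ h₄) :
    m.edge K j a b h₁ ≫ m.edge K k b d h₂ = m.edge K j' a b' h₃ ≫ m.edge K k' b' d h₄ := by
  have mem : ∀ {x y : ℝ × ℝ}, x ∈ S → y ∈ S →
      ∀ t, (Path.segment x y).map K.continuous t ∈ U i :=
    fun hx hy t => hK _ (segment_mem hS hx hy t)
  rw [edge, edge, edge, edge, m.map_indep j i _ h₁ (mem ha hb), m.map_indep k i _ h₂ (mem hb hd),
    m.map_indep j' i _ h₃ (mem ha hb'), m.map_indep k' i _ h₄ (mem hb' hd),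
    ← m.map_trans i _ _ _ _ (trans_mem (mem ha hb) (mem hb hd)),
    ← m.map_trans i _ _ _ _ (trans_mem (mem ha hb') (mem hb' hd))]
  obtain ⟨H, hH⟩ := homotopic_codRestrict hS ((Path.segment a b).trans (Path.segment b d))
    ((Path.segment a b').trans (Path.segment b' d))
    (trans_mem (segment_mem hS ha hb) (segment_mem hS hb hd))
    (trans_mem (segment_mem hS ha hb') (segment_mem hS hb' hd))
  exact m.map_eq_of_homotopy i _ _ _ _
    ((H.map K).cast (Path.map_trans _ _ _) (Path.map_trans _ _ _)) fun t => hK _ (hH t)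

theorem edge_self (i : ι) (z : ℝ × ℝ) (h) : m.edge K i z z h = 𝟙 _ := by
  rw [← m.map_refl i (K z) (fun _ => by simpa using h 0), edge]
  congr 1
  ext t
  simp

/-- When a whole side of the grid maps into one member `U i`, the members chosen by the boxes no
longer matter and the subdivision collapses to a single edge. -/
theorem chain_edge {i : ι} {S : Set (ℝ × ℝ)} (hS : Convex ℝ S) (hK : ∀ z ∈ S, K z ∈ U i)
    {z : ℕ → ℝ × ℝ} (hz : ∀ k, z k ∈ S) (j : ℕ → ι)
    (h : ∀ k t, K (Path.segment (z k) (z (k + 1)) t) ∈ U (j k)) (n : ℕ) :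
    chain (X := fun k => F (K (z k))) (fun k => m.edge K (j k) (z k) (z (k + 1)) (h k)) n =
    m.edge K i (z 0) (z n) fun t => hK _ (segment_mem hS (hz 0) (hz n) t) := by
  induction n with
  | zero => rw [chain, edge_self]
  | succ n ih =>
    rw [chain, ih, m.edge_comp_edge K (j' := i) (k' := i) hS hK (hz 0) (hz n) (hz (n + 1))
      (hz (n + 1)) _ _
      (fun t => hK _ (segment_mem hS (hz 0) (hz (n + 1)) t))
      (fun t => hK _ (segment_mem hS (hz (n + 1)) (hz (n + 1)) t)), edge_self, Category.comp_id]

/-- A local functor takes the same value on two paths inside a member of the cover that are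
homotopic in the whole space. -/
theorem map_eq_of_homotopic (hU : ∀ x, ∃ i, U i ∈ 𝓝 x) {i : ι} {x y : Z} {γ γ' : Path x y}
    (h : ∀ t, γ t ∈ U i) (h' : ∀ t, γ' t ∈ U i) (hh : γ.Homotopic γ') :
    m.map i γ h = m.map i γ' h' := by
  obtain ⟨H⟩ := hh
  obtain ⟨τ, hτ0, hτ, ⟨N, hN⟩, hbox⟩ := exists_monotone_Icc_subset_open_cover_unitInterval_prod_self
    (c := fun j => H ⁻¹' interior (U j)) (fun j => isOpen_interior.preimage H.continuous)
    (fun w _ => by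
      obtain ⟨j, hj⟩ := hU (H w)
      exact Set.mem_iUnion.2 ⟨j, mem_interior_iff_mem_nhds.2 hj⟩)
  choose j hj using hbox
  -- Clamping extends the homotopy to the plane, where straight segments and convexity are
  -- available.
  let K : C(ℝ × ℝ, Z) := ⟨fun w => H (Set.projIcc 0 1 zero_le_one w.1,
    Set.projIcc 0 1 zero_le_one w.2), by fun_prop⟩
  let z : ℕ → ℕ → ℝ × ℝ := fun k l => (τ k, τ l)
  let B : ℕ → ℕ → Set (ℝ × ℝ) := fun k l =>
    Set.Icc (τ k : ℝ) (τ (k + 1)) ×ˢ Set.Icc (τ l : ℝ) (τ (l + 1))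
  have hB : ∀ k l, Convex ℝ (B k l) := fun k l => (convex_Icc _ _).prod (convex_Icc _ _)
  have hKB : ∀ k l, ∀ w ∈ B k l, K w ∈ U (j k l) := by
    rintro k l ⟨u, v⟩ ⟨⟨hu, hu'⟩, hv, hv'⟩
    have hu1 : u ∈ Set.Icc (0 : ℝ) 1 := ⟨(τ k).2.1.trans hu, hu'.trans (τ (k + 1)).2.2⟩
    have hv1 : v ∈ Set.Icc (0 : ℝ) 1 := ⟨(τ l).2.1.trans hv, hv'.trans (τ (l + 1)).2.2⟩
    change H (Set.projIcc 0 1 _ u, Set.projIcc 0 1 _ v) ∈ _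
    rw [Set.projIcc_of_mem _ hu1, Set.projIcc_of_mem _ hv1]
    exact interior_subset (hj k l ⟨⟨hu, hu'⟩, hv, hv'⟩)
  have hm : ∀ k, (τ k : ℝ) ≤ τ (k + 1) := fun k => hτ k.le_succ
  have h00 : ∀ k l, z k l ∈ B k l := fun k l => ⟨⟨le_rfl, hm k⟩, le_rfl, hm l⟩
  have h10 : ∀ k l, z (k + 1) l ∈ B k l := fun k l => ⟨⟨hm k, le_rfl⟩, le_rfl, hm l⟩
  have h01 : ∀ k l, z k (l + 1) ∈ B k l := fun k l => ⟨⟨le_rfl, hm k⟩, hm l, le_rfl⟩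
  have h11 : ∀ k l, z (k + 1) (l + 1) ∈ B k l := fun k l => ⟨⟨hm k, le_rfl⟩, hm l, le_rfl⟩
  have key := chain_comp_chain (X := fun k l => F (K (z k l)))
    (f := fun k l => m.edge K (j k l) (z k l) (z (k + 1) l)
      fun t => hKB k l _ (segment_mem (hB k l) (h00 k l) (h10 k l) t))
    (g := fun k l => m.edge K (j k l) (z k l) (z k (l + 1))
      fun t => hKB k l _ (segment_mem (hB k l) (h00 k l) (h01 k l) t))
    (fun k l => m.edge_comp_edge K (hB k l) (hKB k l) (h00 k l) (h01 k l) (h10 k l) (h11 k l)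
      _ _ _ _) N N
  have hN1 : τ N = 1 := hN N le_rfl
  have hx : x ∈ U i := by simpa using h 0
  have hy : y ∈ U i := by simpa using h 1
  have eL : ∀ v : ℝ, K (0, v) = γ (Set.projIcc 0 1 zero_le_one v) := fun v => by simp [K]
  have eR : ∀ v : ℝ, K (1, v) = γ' (Set.projIcc 0 1 zero_le_one v) := fun v => by simp [K]
  have eB : ∀ u : ℝ, K (u, 0) = x := fun u => by simp [K]
  have eT : ∀ u : ℝ, K (u, 1) = y := fun u => by simp [K]
  -- Each of the four sides lies in `U i`: two carry `γ` and `γ'`, the others are constant at the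
  -- endpoints.
  have cL := m.chain_edge K (i := i) (S := {0} ×ˢ Set.univ) (z := z 0) (j := j 0)
    ((convex_singleton _).prod convex_univ)
    (by rintro ⟨u, v⟩ ⟨rfl, -⟩; rw [eL]; exact h _) (by simp [z, hτ0])
    (fun l t => hKB 0 l _ (segment_mem (hB 0 l) (h00 0 l) (h01 0 l) t)) N
  have cR := m.chain_edge K (i := i) (S := {1} ×ˢ Set.univ) (z := z N) (j := j N)
    ((convex_singleton _).prod convex_univ)
    (by rintro ⟨u, v⟩ ⟨rfl, -⟩; rw [eR]; exact h' _) (by simp [z, hN1])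
    (fun l t => hKB N l _ (segment_mem (hB N l) (h00 N l) (h01 N l) t)) N
  have cB := m.chain_edge K (i := i) (S := Set.univ ×ˢ {0}) (z := (z · 0)) (j := (j · 0))
    (convex_univ.prod (convex_singleton _))
    (by rintro ⟨u, v⟩ ⟨-, rfl⟩; rw [eB]; exact hx) (by simp [z, hτ0])
    (fun k t => hKB k 0 _ (segment_mem (hB k 0) (h00 k 0) (h10 k 0) t)) N
  have cT := m.chain_edge K (i := i) (S := Set.univ ×ˢ {1}) (z := (z · N)) (j := (j · N))
    (convex_univ.prod (convex_singleton _))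
    (by rintro ⟨u, v⟩ ⟨-, rfl⟩; rw [eT]; exact hy) (by simp [z, hN1])
    (fun k t => hKB k N _ (segment_mem (hB k N) (h00 k N) (h10 k N) t)) N
  have key' := (congrArg₂ _ cL cT).symm.trans (key.trans (congrArg₂ _ cB cR))
  have k00 : K (z 0 0) = x := by simp only [z, hτ0]; exact eB _
  have k10 : K (z N 0) = x := by simp only [z, hτ0]; exact eB _
  have k01 : K (z 0 N) = y := by simp only [z, hN1]; exact eT _
  have k11 : K (z N N) = y := by simp only [z, hN1]; exact eT _
  have hx' : ∀ t, Path.refl x t ∈ U i := fun _ => hx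
  have hy' : ∀ t, Path.refl y t ∈ U i := fun _ => hy
  rw [m.edge_congr K _ k00 k01 (γ := γ) h, m.edge_congr K _ k01 k11 (γ := .refl y) hy',
    m.edge_congr K _ k00 k10 (γ := .refl x) hx', m.edge_congr K _ k10 k11 (γ := γ') h',
    m.map_refl, m.map_refl] at key'
  · simp only [Category.assoc, Category.id_comp, eqToHom_trans, eqToHom_trans_assoc] at key'
    exact (cancel_mono _).1 ((cancel_epi _).1 key')
  all_goals
    intro t
    simp [z, hτ0, hN1, AffineMap.lineMap_apply, eL, eR, eB, eT]

end LocalFunctor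

end PuncturedSurface

/-! ### Patches of the cover, base points and regular replacements of paths -/

namespace PuncturedSurface

variable {X : Type*} [TopologicalSpace X] {Pu : Set X}

namespace PunctureDisc

theorem disc_mem_nhds (D : PunctureDisc Pu) : D.disc ∈ 𝓝 (D.center : X) := by
  have h : D.chart '' Metric.ball 0 1 ∈ 𝓝 (D.center : X) :=
    (D.chart.isOpen_image_of_subset_source Metric.isOpen_ball
      (Metric.ball_subset_closedBall.trans D.closedBall_subset)).mem_nhds
      ⟨0, Metric.mem_ball_self one_pos, rfl⟩
  exact Filter.mem_of_superset h (Set.image_mono Metric.ball_subset_closedBall)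

theorem eq_center_of_mem_disc (D : PunctureDisc Pu) {P : Pu} (hP : (P : X) ∈ D.disc) :
    P = D.center := by
  obtain ⟨z, hz, e⟩ := hP
  obtain rfl := D.eq_center z hz (e ▸ P.2)
  exact Subtype.ext e.symm

end PunctureDisc

variable [ChartedSpace (EuclideanHalfSpace 2) X] {A : ArcSystem Pu}

theorem ArcSystem.exists_punctureDisc [T2Space X] [Finite Pu] (A : ArcSystem Pu) (P : Pu) :
    ∃ D : PunctureDisc Pu, D.center = P := by
  have hP : (P : X) ∈ (𝓡∂ 2).interior X := A.arc_one P ▸ A.arc_interior P 1 one_ne_zero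
  have hN : (Pu \ {(P : X)})ᶜ ∈ 𝓝 (P : X) :=
    ((Set.toFinite Pu).sdiff.isClosed).isOpen_compl.mem_nhds fun h => h.2 rfl
  obtain ⟨e, he, he0, heN⟩ := exists_disc_chart hP hN
  have h0 : (0 : ℂ) ∈ Metric.closedBall (0 : ℂ) 1 := by simp
  refine ⟨⟨e, he, he0 ▸ P.2, fun z hz hzP => e.injOn (he hz) (he h0) ?_⟩, Subtype.ext he0⟩
  rw [he0]
  by_contra hne
  exact heN ⟨z, hz, rfl⟩ ⟨hzP, hne⟩

namespace Cut

variable {Y : Type*} [TopologicalSpace Y] [ChartedSpace (EuclideanHalfSpace 2) Y] {c : Cut A Y}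
  {D : Pu → PunctureDisc Pu}

variable (c D) in
/-- The cover of the surface `Σ̃` by the complement of the fibres of the punctures and the
preimages of discs around the punctures. -/
def patch : Option Pu → Set c.Cover
  | none => c.regular
  | some P => c.proj ⁻¹' (D P).disc

variable (c D) in
/-- A choice, for every point of `Σ̃`, of a path from a regular point to it: the constant path at
a regular point, a path inside the preimages of the discs in general. -/
structure Basing where
  base : c.Cover → c.regular
  path : ∀ x, Path (base x).1 x
  path_eq : ∀ x ∈ c.regular, ∀ t, path x t = x
  path_mem : ∀ x P, c.proj x ∈ (D P).disc → ∀ t, c.proj (path x t) ∈ (D P).disc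

/-- Constancy of `r` and `s` is known only pointwise. After substitution the conjugation by them
disappears, and `γ` itself, viewed in the regular part, is the required path. -/
theorem exists_regular_path_of_const {a b : c.regular} {x y : c.Cover} (r : Path a.1 x)
    (s : Path b.1 y) (hr : ∀ t, r t = x) (hs : ∀ t, s t = y) (γ : Path x y)
    (hγ : ∀ t, γ t ∈ c.regular) :
    ∃ δ : Path a b, (∀ t, (δ t).1 = γ t) ∧ (Path.Homotopic.Quotient.mk δ).map c.regularIncl =
      ((Path.Homotopic.Quotient.mk r).trans (.mk γ)).trans (Path.Homotopic.Quotient.mk s).symm := by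
  obtain rfl : a.1 = x := by rw [← hr 0, r.source]
  obtain rfl : b.1 = y := by rw [← hs 0, s.source]
  obtain rfl : r = .refl _ := Path.ext (funext hr)
  obtain rfl : s = .refl _ := Path.ext (funext hs)
  refine ⟨⟨⟨fun t => ⟨γ t, hγ t⟩, by fun_prop⟩, by simp, by simp⟩, fun _ => rfl, ?_⟩
  have e : (Path.Homotopic.Quotient.mk (.refl b.1)).symm = .refl b.1 :=
    congrArg Path.Homotopic.Quotient.mk Path.refl_symm
  rw [e, Path.Homotopic.Quotient.mk_refl, Path.Homotopic.Quotient.refl_trans,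
    Path.Homotopic.Quotient.trans_refl]
  rfl

variable [T2Space X] [T2Space Y] [CompactSpace Y] [Finite Pu]

omit [T2Space X] [T2Space Y] [CompactSpace Y] [Finite Pu] in
theorem exists_eq_cone {x : c.Cover} (hx : x ∉ c.regular) : ∃ P : Pu, x = c.cone P :=
  ⟨⟨c.proj x, not_not.1 hx⟩, c.eq_cone_of_proj_eq rfl⟩

omit [T2Space X] [T2Space Y] [CompactSpace Y] [Finite Pu] in
theorem eq_of_cone_mem_patch (hD : ∀ P, (D P).center = P) {P Q : Pu}
    (h : c.cone P ∈ c.patch D (some Q)) : P = Q := by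
  have h' : c.proj (c.cone P) ∈ (D Q).disc := h
  rw [proj_cone] at h'
  rw [(D Q).eq_center_of_mem_disc h', hD]

omit [T2Space Y] [CompactSpace Y] in
theorem exists_patch_mem_nhds (hD : ∀ P, (D P).center = P) (x : c.Cover) :
    ∃ i, c.patch D i ∈ 𝓝 x := by
  by_cases hx : x ∈ c.regular
  · exact ⟨none, ((Set.toFinite Pu).isClosed.preimage c.proj.continuous).isOpen_compl.mem_nhds hx⟩
  · obtain ⟨P, rfl⟩ := exists_eq_cone hx
    refine ⟨some P, c.proj.continuous.continuousAt.preimage_mem_nhds ?_⟩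
    have h := (D P).disc_mem_nhds
    rwa [hD, ← c.proj_cone P] at h

theorem nonempty_basing (hD : ∀ P, (D P).center = P) : Nonempty (c.Basing D) := by
  have h : ∀ x : c.Cover, ∃ (a : c.regular) (r : Path a.1 x), (x ∈ c.regular → ∀ t, r t = x) ∧
      ∀ P, c.proj x ∈ (D P).disc → ∀ t, c.proj (r t) ∈ (D P).disc := fun x => by
    by_cases hx : x ∈ c.regular
    · exact ⟨⟨x, hx⟩, .refl x, fun _ _ => rfl, fun P h _ => h⟩
    · obtain ⟨P, rfl⟩ := exists_eq_cone hx
      have h := exists_path_to_cone c (D P)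
      rw [hD] at h
      obtain ⟨a, r, hr⟩ := h
      refine ⟨a, r, fun h => absurd h hx, fun Q hQ => ?_⟩
      obtain rfl := eq_of_cone_mem_patch hD hQ
      exact hr
  choose a r h h' using h
  exact ⟨⟨a, r, h, h'⟩⟩

namespace Basing

variable (B : c.Basing D)

omit [T2Space X] [T2Space Y] [CompactSpace Y] [Finite Pu] in
theorem base_mem {x : c.Cover} {P : Pu} (hx : x ∈ c.patch D (some P)) :
    c.proj (B.base x) ∈ (D P).disc := by
  simpa using B.path_mem x P hx 0

/-! ### Paths between regular points can be moved off the fibres of the punctures -/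

/-- The class of the path is represented by a regular path between the base points. -/
def Representable {x y : c.Cover} (γ : Path.Homotopic.Quotient x y) : Prop :=
  ∃ δ : Path.Homotopic.Quotient (B.base x) (B.base y), δ.map c.regularIncl =
    ((Path.Homotopic.Quotient.mk (B.path x)).trans γ).trans (Path.Homotopic.Quotient.mk (B.path y)).symm

omit [T2Space X] [T2Space Y] [CompactSpace Y] [Finite Pu] in
theorem Representable.trans {x y z : c.Cover} {γ : Path.Homotopic.Quotient x y} {γ' : Path.Homotopic.Quotient y z}
    (h : B.Representable γ) (h' : B.Representable γ') : B.Representable (γ.trans γ') := by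
  obtain ⟨δ, hδ⟩ := h
  obtain ⟨δ', hδ'⟩ := h'
  have key : ∀ {u v w : c.Cover} (p : Path.Homotopic.Quotient u x)
      (q : Path.Homotopic.Quotient v y) (r : Path.Homotopic.Quotient w z),
      ((p.trans γ).trans q.symm).trans ((q.trans γ').trans r.symm) =
        (p.trans (γ.trans γ')).trans r.symm := fun p q r => by
    simp only [Path.Homotopic.Quotient.trans_assoc]
    rw [← Path.Homotopic.Quotient.trans_assoc q.symm]
    simp
  refine ⟨δ.trans δ', ?_⟩
  rw [map_quotient_trans, hδ, hδ']
  exact key _ _ _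

theorem representable_of_mem_patch {x y : c.Cover} (γ : Path x y) {i : Option Pu}
    (h : ∀ t, γ t ∈ c.patch D i) : B.Representable (.mk γ) := by
  have hx : x ∈ c.patch D i := by simpa using h 0
  have hy : y ∈ c.patch D i := by simpa using h 1
  cases i with
  | none =>
    obtain ⟨δ, -, hδ⟩ := exists_regular_path_of_const (B.path x) (B.path y) (B.path_eq x hx)
      (B.path_eq y hy) γ h
    exact ⟨.mk δ, hδ⟩
  | some P =>
    obtain ⟨δ, hδ⟩ := exists_regular_path_homotopic (D P)
      (((B.path x).trans γ).trans (B.path y).symm)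
      (LocalFunctor.trans_mem (S := c.proj ⁻¹' (D P).disc)
        (LocalFunctor.trans_mem (B.path_mem x P hx) h) fun t => B.path_mem y P hy (σ t))
    exact ⟨.mk δ, Path.Homotopic.Quotient.eq.2 hδ⟩

/-- A subdivision puts each piece of the path into one patch, and representability is stable under
composition since the basing paths cancel. -/
theorem representable (hD : ∀ P, (D P).center = P) {x y : c.Cover} (γ : Path x y) :
    B.Representable (.mk γ) := by
  obtain ⟨τ, hτ0, hτ, ⟨N, hN⟩, hbox⟩ := exists_monotone_Icc_subset_open_cover_unitInterval
    (c := fun j => γ ⁻¹' interior (c.patch D j))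
    (fun j => isOpen_interior.preimage γ.continuous)
    (fun w _ => by
      obtain ⟨j, hj⟩ := exists_patch_mem_nhds hD (γ w)
      exact Set.mem_iUnion.2 ⟨j, mem_interior_iff_mem_nhds.2 hj⟩)
  have small : ∀ n, B.Representable (.mk (γ.subpath (τ n) (τ (n + 1)))) := fun n => by
    obtain ⟨j, hj⟩ := hbox n
    refine B.representable_of_mem_patch _ (i := j) fun t => ?_
    have ht := Set.mem_range_self (f := γ.subpath (τ n) (τ (n + 1))) t
    rw [Path.range_subpath_of_le _ _ _ (hτ n.le_succ)] at ht
    obtain ⟨s, hs, e⟩ := ht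
    rw [← e]
    exact interior_subset (hj hs)
  have all : ∀ n, B.Representable (.mk (γ.subpath (τ 0) (τ (n + 1)))) := fun n => by
    induction n with
    | zero => exact small 0
    | succ n ih =>
      have := ih.trans B (small (n + 1))
      rwa [← Path.Homotopic.Quotient.mk_trans, Path.Homotopic.Quotient.eq.2 ⟨Path.Homotopy.subpathTransSubpath _ _ _ _⟩] at this
  have h1 := all N
  rw [hN _ N.le_succ, hτ0, Path.subpath_zero_one] at h1
  have e0 := γ.source
  have e1 := γ.target
  have aux : ∀ {u v : c.Cover} (hu : u = x) (hv : v = y),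
      B.Representable (.mk (γ.cast hu hv)) → B.Representable (.mk γ) := by
    rintro u v rfl rfl h
    exact h
  exact aux e0 e1 h1

/-- At regular points the basing paths are constant, so representability becomes a statement about
the class itself. -/
theorem exists_map_regularIncl_eq (B : c.Basing D) (hD : ∀ P, (D P).center = P) {a b : c.regular}
    (α : Path.Homotopic.Quotient a.1 b.1) : ∃ δ : Path.Homotopic.Quotient a b, δ.map c.regularIncl = α := by
  induction α using Path.Homotopic.Quotient.ind with | mk γ =>
  obtain ⟨δ, hδ⟩ := B.representable hD γ
  have aux : ∀ {a' b' : c.regular} (r : Path a'.1 a.1) (s : Path b'.1 b.1) (_ : ∀ t, r t = a.1)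
      (_ : ∀ t, s t = b.1) (δ : Path.Homotopic.Quotient a' b'), δ.map c.regularIncl =
        ((Path.Homotopic.Quotient.mk r).trans (.mk γ)).trans (Path.Homotopic.Quotient.mk s).symm →
      ∃ δ : Path.Homotopic.Quotient a b, δ.map c.regularIncl = .mk γ := by
    clear δ hδ
    intro a' b' r s hr hs δ hδ
    obtain rfl : a' = a := Subtype.ext (by rw [← hr 0, r.source])
    obtain rfl : b' = b := Subtype.ext (by rw [← hs 0, s.source])
    obtain rfl : r = .refl _ := Path.ext (funext hr)
    obtain rfl : s = .refl _ := Path.ext (funext hs)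
    refine ⟨δ, hδ.trans ?_⟩
    have e : (Path.Homotopic.Quotient.mk (.refl b'.1)).symm = .refl b'.1 :=
      congrArg Path.Homotopic.Quotient.mk Path.refl_symm
    rw [e, Path.Homotopic.Quotient.mk_refl, Path.Homotopic.Quotient.refl_trans,
      Path.Homotopic.Quotient.trans_refl]
    rfl
  exact aux _ _ (B.path_eq _ a.2) (B.path_eq _ b.2) δ hδ

/-! ### Regular paths that are homotopic in `Σ̃` have the same image in the orbifold groupoid -/

/-- The regular path `δ` replaces the path `γ` inside a member of the cover. -/
def Replaces : ∀ (_ : Option Pu) {x y : c.Cover} (_ : Path x y)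
    (_ : Path (B.base x) (B.base y)), Prop
  | none, _, _, γ, δ => ∀ t, (δ t).1 = γ t
  | some P, _, _, _, δ => ∀ t, (δ t).1 ∈ c.patch D (some P)

theorem exists_replaces {i : Option Pu} {x y : c.Cover} {γ : Path x y}
    (h : ∀ t, γ t ∈ c.patch D i) : ∃ δ, B.Replaces i γ δ := by
  have hx : x ∈ c.patch D i := by simpa using h 0
  have hy : y ∈ c.patch D i := by simpa using h 1
  cases i with
  | none =>
    obtain ⟨δ, hδ, -⟩ := exists_regular_path_of_const (B.path x) (B.path y) (B.path_eq x hx)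
      (B.path_eq y hy) γ h
    exact ⟨δ, hδ⟩
  | some P => exact exists_regular_path_of_disc (D P) (B.base_mem hx) (B.base_mem hy)

variable {B} in
-- In the regular patch the homotopy itself projects. Over a disc no comparison with `γ` and `γ'` is
-- needed: there the endpoints alone determine the orbifold class.
theorem Replaces.orbClass_eq {i : Option Pu} {x y : c.Cover} {γ γ' : Path x y}
    {δ δ' : Path (B.base x) (B.base y)} (hδ : B.Replaces i γ δ) (hδ' : B.Replaces i γ' δ')
    (h : ∀ t, γ t ∈ c.patch D i) (H : γ.Homotopy γ') (hH : ∀ t, H t ∈ c.patch D i) :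
    orbClass (δ.map c.projRegular.continuous) = orbClass (δ'.map c.projRegular.continuous) := by
  cases i with
  | none =>
    refine orbClass_eq_of_homotopic (Path.Homotopic.map (f := c.projRegular) ?_)
    have hx : x = (B.base x).1 := by simpa using (hδ 0).symm
    have hy : y = (B.base y).1 := by simpa using (hδ 1).symm
    exact ⟨⟨⟨⟨fun t => ⟨H t, hH t⟩, by fun_prop⟩, fun t => Subtype.ext (by simp [hδ t]),
      fun t => Subtype.ext (by simp [hδ' t])⟩, by
        rintro t s (rfl | rfl) <;> exact Subtype.ext (by simp [← hx, ← hy])⟩⟩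
  | some P => exact orbClass_map_eq_of_disc (D P) δ δ' hδ hδ'

/-- The class in the orbifold groupoid of the projection of a regular replacement of a path. -/
noncomputable def localMap (i : Option Pu) {x y : c.Cover} (γ : Path x y)
    (h : ∀ t, γ t ∈ c.patch D i) :
    (OrbifoldGroupoid.quotientFunctor Pu).obj ⟨c.projRegular (B.base x)⟩ ⟶
      (OrbifoldGroupoid.quotientFunctor Pu).obj ⟨c.projRegular (B.base y)⟩ :=
  orbClass ((B.exists_replaces h).choose.map c.projRegular.continuous)

theorem localMap_eq {i : Option Pu} {x y : c.Cover} {γ : Path x y}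
    (h : ∀ t, γ t ∈ c.patch D i) {δ : Path (B.base x) (B.base y)} (hδ : B.Replaces i γ δ) :
    B.localMap i γ h = orbClass (δ.map c.projRegular.continuous) :=
  (B.exists_replaces h).choose_spec.orbClass_eq hδ h (.refl γ) fun t => h t.2

theorem localMap_none_eq {P : Pu} {x y : c.Cover} {γ : Path x y} (h : ∀ t, γ t ∈ c.patch D none)
    (h' : ∀ t, γ t ∈ c.patch D (some P)) : B.localMap none γ h = B.localMap (some P) γ h' := by
  obtain ⟨δ, hδ⟩ := B.exists_replaces h
  rw [B.localMap_eq h hδ, B.localMap_eq h' (δ := δ)]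
  intro t
  rw [hδ t]
  exact h' t

/-- The projections of regular replacements of paths form a local functor. -/
noncomputable def localFunctor (hD : ∀ P, (D P).center = P) : LocalFunctor (c.patch D)
    fun x => (OrbifoldGroupoid.quotientFunctor Pu).obj ⟨c.projRegular (B.base x)⟩ where
  map := B.localMap
  map_indep i j x y γ hi hj := by
    match i, j with
    | none, none => rfl
    | none, some P => exact B.localMap_none_eq hi hj
    | some P, none => exact (B.localMap_none_eq hj hi).symm
    | some P, some Q =>
      by_cases hPQ : P = Q
      · subst hPQ
        rfl
      -- The discs of `P` and `Q` may overlap, but each contains only its own puncture. A path over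
      -- both is therefore regular, and the regular patch mediates between the two values.
      have h : ∀ t, γ t ∈ c.patch D none := fun t => by
        by_contra hne
        obtain ⟨R, hR⟩ := exists_eq_cone hne
        exact hPQ ((eq_of_cone_mem_patch hD (hR ▸ hi t)).symm.trans
          (eq_of_cone_mem_patch hD (hR ▸ hj t)))
      exact (B.localMap_none_eq h hi).symm.trans (B.localMap_none_eq h hj)
  map_refl i x h := by
    rw [B.localMap_eq h (δ := .refl _)]
    · exact orbClass_refl _
    · cases i with
      | none => exact fun t => (Path.source _).symm.trans (B.path_eq x (h 0) 0)
      | some P => exact fun t => B.base_mem (h 0)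
  map_trans i x y z γ γ' h h' h'' := by
    obtain ⟨δ, hδ⟩ := B.exists_replaces h
    obtain ⟨δ', hδ'⟩ := B.exists_replaces h'
    rw [B.localMap_eq h hδ, B.localMap_eq h' hδ', ← orbClass_trans, ← Path.map_trans]
    refine B.localMap_eq h'' ?_
    cases i with
    | none =>
      intro t
      rw [Path.trans_apply, Path.trans_apply]
      split
      · exact hδ _
      · exact hδ' _
    | some P => exact LocalFunctor.trans_mem (S := {a : c.regular | a.1 ∈ c.patch D (some P)}) hδ hδ'
  map_eq_of_homotopy i x y γ γ' h h' H hH :=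
    (B.exists_replaces h).choose_spec.orbClass_eq (B.exists_replaces h').choose_spec h H hH

/-- The homotopy may cross the fibres of the punctures, where the orbifold class of a path is
undefined; the local functor assigns values to such paths as well, so homotopy invariance applies to
it. -/
theorem orbClass_eq_of_homotopic_incl (B : c.Basing D) (hD : ∀ P, (D P).center = P) {a b : c.regular}
    {δ δ' : Path a b} (h : (δ.map c.regularIncl.continuous).Homotopic
      (δ'.map c.regularIncl.continuous)) :
    orbClass (δ.map c.projRegular.continuous) = orbClass (δ'.map c.projRegular.continuous) := by
  have h₁ : ∀ t, δ.map c.regularIncl.continuous t ∈ c.patch D none := fun t => (δ t).2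
  have h₂ : ∀ t, δ'.map c.regularIncl.continuous t ∈ c.patch D none := fun t => (δ' t).2
  have key : B.localMap none _ h₁ = B.localMap none _ h₂ :=
    (B.localFunctor hD).map_eq_of_homotopic (exists_patch_mem_nhds hD) h₁ h₂ h
  obtain ⟨ε, hε⟩ := B.exists_replaces h₁
  obtain ⟨ε', hε'⟩ := B.exists_replaces h₂
  rw [B.localMap_eq h₁ hε, B.localMap_eq h₂ hε'] at key
  have aux : ∀ {a' b' : c.regular} (ε ε' : Path a' b'), (∀ t, ε t = δ t) → (∀ t, ε' t = δ' t) →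
      orbClass (ε.map c.projRegular.continuous) = orbClass (ε'.map c.projRegular.continuous) →
      orbClass (δ.map c.projRegular.continuous) = orbClass (δ'.map c.projRegular.continuous) := by
    clear key hε hε' ε ε'
    intro a' b' ε ε' hε hε' hεε
    obtain rfl : a' = a := by rw [← ε.source, hε, δ.source]
    obtain rfl : b' = b := by rw [← ε.target, hε, δ.target]
    obtain rfl : ε = δ := Path.ext (funext hε)
    obtain rfl : ε' = δ' := Path.ext (funext hε')
    exact hεε
  exact aux ε ε' (fun t => Subtype.ext (hε t)) (fun t => Subtype.ext (hε' t)) key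

end Basing

end Cut

end PuncturedSurface

/-! ### The functor to the orbifold groupoid and its properties -/

namespace PuncturedSurface

namespace Cut

variable {X : Type*} [TopologicalSpace X] [ChartedSpace (EuclideanHalfSpace 2) X]
  {Pu : Set X} {A : ArcSystem Pu} {Y : Type*} [TopologicalSpace Y]
  [ChartedSpace (EuclideanHalfSpace 2) Y] (c : Cut A Y)

/-- The morphism of the orbifold groupoid given by the projection of a class of regular paths. -/
noncomputable def projOrb {a b : c.regular} (α : Path.Homotopic.Quotient a b) :
    (OrbifoldGroupoid.quotientFunctor Pu).obj ⟨c.projRegular a⟩ ⟶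
      (OrbifoldGroupoid.quotientFunctor Pu).obj ⟨c.projRegular b⟩ :=
  (FundamentalGroupoid.map c.projRegular ⋙ OrbifoldGroupoid.quotientFunctor Pu).map
    (X := ⟨a⟩) (Y := ⟨b⟩) α

theorem projOrb_refl (a : c.regular) : c.projOrb (.refl a) = 𝟙 _ :=
  (FundamentalGroupoid.map c.projRegular ⋙ OrbifoldGroupoid.quotientFunctor Pu).map_id ⟨a⟩

theorem projOrb_trans {a b d : c.regular} (α : Path.Homotopic.Quotient a b)
    (β : Path.Homotopic.Quotient b d) : c.projOrb (α.trans β) = c.projOrb α ≫ c.projOrb β :=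
  (FundamentalGroupoid.map c.projRegular ⋙ OrbifoldGroupoid.quotientFunctor Pu).map_comp
    (X := ⟨a⟩) (Y := ⟨b⟩) (Z := ⟨d⟩) α β

variable [T2Space X] [T2Space Y] [CompactSpace Y] [Finite Pu]

theorem nonempty_basing_of_finite : ∃ D : Pu → PunctureDisc Pu, (∀ P, (D P).center = P) ∧
    Nonempty (c.Basing D) := by
  choose D hD using A.exists_punctureDisc
  exact ⟨D, hD, nonempty_basing hD⟩

theorem exists_map_regularIncl_eq {a b : c.regular} (α : Path.Homotopic.Quotient a.1 b.1) :
    ∃ δ : Path.Homotopic.Quotient a b, δ.map c.regularIncl = α := by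
  obtain ⟨D, hD, ⟨B⟩⟩ := c.nonempty_basing_of_finite
  exact B.exists_map_regularIncl_eq hD α

/-- Two classes of regular paths have the same image in the fundamental groupoid of `Σ̃` if and
only if their projections have the same image in the orbifold groupoid. -/
theorem projOrb_eq_iff {a b : c.regular} {α β : Path.Homotopic.Quotient a b} :
    c.projOrb α = c.projOrb β ↔ α.map c.regularIncl = β.map c.regularIncl := by
  refine ⟨map_regularIncl_eq, fun h => ?_⟩
  obtain ⟨D, hD, ⟨B⟩⟩ := c.nonempty_basing_of_finite
  induction α using Path.Homotopic.Quotient.ind with | mk δ =>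
  induction β using Path.Homotopic.Quotient.ind with | mk δ' =>
  exact B.orbClass_eq_of_homotopic_incl hD (Path.Homotopic.Quotient.eq.1 h)

/-- The functor `π₁(Σ̃, Σ̃ ∖ p⁻¹(Pu)) → π₁ᵒʳᵇ(Σ, Σ ∖ Pu)` induced by the projection. -/
noncomputable def orbFunctor : FundamentalGroupoidOn c.Cover c.regular ⥤ OrbifoldGroupoid Pu where
  obj a := (OrbifoldGroupoid.quotientFunctor Pu).obj ⟨c.projRegular a⟩
  map {a b} f := c.projOrb (c.exists_map_regularIncl_eq (a := a) (b := b) f.hom).choose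
  map_id a := by
    rw [← c.projOrb_refl a, projOrb_eq_iff]
    exact (c.exists_map_regularIncl_eq (a := a) (b := a) _).choose_spec
  map_comp {a b d} f g := by
    rw [← c.projOrb_trans, projOrb_eq_iff, map_quotient_trans]
    refine (c.exists_map_regularIncl_eq (a := a) (b := d) _).choose_spec.trans ?_
    rw [(c.exists_map_regularIncl_eq (a := a) (b := b) f.hom).choose_spec,
      (c.exists_map_regularIncl_eq (a := b) (b := d) g.hom).choose_spec]
    rfl

/-- The choice of a regular representative in `orbFunctor` is immaterial, because homotopy in `Σ̃`
implies equality of projections. -/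
theorem orbFunctor_map {a b : c.regular} {f : InducedCategory.Hom (D := FundamentalGroupoid c.Cover)
    (F := fun x : c.regular => FundamentalGroupoid.mk x.1) a b} {α : Path.Homotopic.Quotient a b}
    (h : α.map c.regularIncl = f.hom) :
    c.orbFunctor.map (X := a) (Y := b) f = c.projOrb α := by
  refine c.projOrb_eq_iff.2 ?_
  rw [h]
  exact (c.exists_map_regularIncl_eq (a := a) (b := b) f.hom).choose_spec

end Cut

end PuncturedSurface

theorem mainTheorem8
    {X Y : Type*}
    [TopologicalSpace X] [ChartedSpace (EuclideanHalfSpace 2) X] [T2Space X] [CompactSpace X]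
    [TopologicalSpace Y] [ChartedSpace (EuclideanHalfSpace 2) Y] [T2Space Y] [CompactSpace Y]
    (Pu : Set X) (hPu : Pu.Finite)
    (A : PuncturedSurface.ArcSystem Pu) (c : PuncturedSurface.Cut A Y) :
    ∃ Φ : PuncturedSurface.FundamentalGroupoidOn c.Cover c.regular ⥤
        PuncturedSurface.OrbifoldGroupoid Pu,
      (PuncturedSurface.inclusionFunctor c.regular ⋙ Φ =
        FundamentalGroupoid.map c.projRegular ⋙
          PuncturedSurface.OrbifoldGroupoid.quotientFunctor Pu) ∧
      (∀ Φ' : PuncturedSurface.FundamentalGroupoidOn c.Cover c.regular ⥤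
          PuncturedSurface.OrbifoldGroupoid Pu,
        PuncturedSurface.inclusionFunctor c.regular ⋙ Φ' =
          FundamentalGroupoid.map c.projRegular ⋙
            PuncturedSurface.OrbifoldGroupoid.quotientFunctor Pu → Φ' = Φ) ∧
      Φ.Faithful ∧
      Function.Surjective Φ.obj ∧
      ∀ y, {x | Φ.obj x = y}.encard = 2 := by
  have := hPu.to_subtype
  have hΦ : PuncturedSurface.inclusionFunctor c.regular ⋙ c.orbFunctor =
      FundamentalGroupoid.map c.projRegular ⋙
        PuncturedSurface.OrbifoldGroupoid.quotientFunctor Pu :=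
    CategoryTheory.Functor.hext (fun _ => rfl) fun a b f =>
      heq_of_eq (c.orbFunctor_map (a := a.as) (b := b.as) (α := f) rfl)
  have hfib : ∀ y, ∃ a : c.regular, {x | c.orbFunctor.obj x = y} = {a, c.swapRegular a} := by
    rintro ⟨⟨y⟩⟩
    obtain ⟨a, ha⟩ := c.proj_surjective y
    have har : a ∈ c.regular := fun h => y.2 (ha ▸ h)
    refine ⟨⟨a, har⟩, Set.ext fun (b : c.regular) => ?_⟩
    have key : c.orbFunctor.obj b = ⟨⟨y⟩⟩ ↔ c.projRegular b = c.projRegular ⟨a, har⟩ := by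
      have hy : c.projRegular ⟨a, har⟩ = y := Subtype.ext ha
      rw [hy]
      exact ⟨fun h => congrArg (fun z => z.as.as) h, fun h => h ▸ rfl⟩
    refine key.trans ⟨fun h => c.eq_or_eq_swapRegular h.symm, ?_⟩
    rintro (rfl | rfl)
    · rfl
    · exact c.projRegular_swapRegular _
  refine ⟨c.orbFunctor, hΦ, fun Φ' h' => ?_, ⟨fun {a b f g} h => ?_⟩, fun y => ?_, fun y => ?_⟩
  -- `inclusionFunctor` is bijective on objects and full, so a functor is determined by its
  -- composite with it.
  · have h := h'.trans hΦ.symm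
    have hobj : ∀ a : c.regular, Φ'.obj a = c.orbFunctor.obj a := fun a =>
      CategoryTheory.Functor.congr_obj h ⟨a⟩
    refine CategoryTheory.Functor.ext hobj fun a b f => ?_
    obtain ⟨α, hα⟩ := c.exists_map_regularIncl_eq (a := a) (b := b) f.hom
    have hf : f = (PuncturedSurface.inclusionFunctor c.regular).map (X := ⟨a⟩) (Y := ⟨b⟩) α :=
      InducedCategory.hom_ext hα.symm
    rw [hf]
    exact CategoryTheory.Functor.congr_hom h (X := ⟨a⟩) (Y := ⟨b⟩) α
  · obtain ⟨α, hα⟩ := c.exists_map_regularIncl_eq (a := a) (b := b) f.hom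
    obtain ⟨β, hβ⟩ := c.exists_map_regularIncl_eq (a := a) (b := b) g.hom
    rw [c.orbFunctor_map (a := a) (b := b) hα, c.orbFunctor_map (a := a) (b := b) hβ] at h
    exact InducedCategory.hom_ext (hα.symm.trans ((c.projOrb_eq_iff.1 h).trans hβ))
  · obtain ⟨a, ha⟩ := hfib y
    exact ⟨a, ha.ge (Set.mem_insert _ _)⟩
  · obtain ⟨a, ha⟩ := hfib y
    rw [ha]
    -- The fibre has two distinct elements since the involution has no fixed points on the regular
    -- part.
    exact Set.encard_pair (c.swapRegular_ne a).symm
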